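/- Let $U_n$, $n\ge 0$, be simply connected domains, each a proper subset of $\mathbb C$ (not necessarily distinct or disjoint), and for $n\ge 1$ let $f_n:U_{n-1}\to U_n$ be a non-constant holomorphic map (not necessarily surjective). Put $F_0=\mathrm{id}$ and $F_n=f_n\circ\cdots\circ f_1$ for $n\ge 1$, and let $$E=\{(z,z')\in U_0\times U_0 : F_n(z)=F_n(z')\text{ for some } n\ge 1\}.$$ For a simply connected domain $U\subsetneq\mathbb C$ and a conformal bijection $\varphi$ of $U$ onto the unit disc $\mathbb D$, the hyperbolic density and distance of $U$ are $$\rho_U(z)=\frac{2|\varphi'(z)|}{1-|\varphi(z)|^2},\qquad \operatorname{dist}_U(z,w)=\log\frac{1+t}{1-t},\quad t=\left|\frac{\varphi(z)-\varphi(w)}{1-\overline{\varphi(w)}\,\varphi(z)}\right|;$$ they do not depend on the choice of $\varphi$. For $n\ge1$ and $z\in U_0$ let $$\lambda_n(z)=\frac{\rho_{U_n}(F_n(z))\,|f_n'(F_{n-1}(z))|}{\rho_{U_{n-1}}(F_{n-1}(z))}$$ be the hyperbolic distortion of $f_n:U_{n-1}\to U_n$ at $F_{n-1}(z)$. Then exactly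 one of the following holds. 1. (Contracting) $\operatorname{dist}_{U_n}(F_n(z),F_n(z'))\to 0$ as $n\to\infty$, for all $z,z'\in U_0$. 2. (Semi-contracting) For every $(z,z')\in(U_0\times U_0)\setminus E$ there is $c(z,z')>0$ such that $\operatorname{dist}_{U_n}(F_n(z),F_n(z'))\to c(z,z')$ as $n\to\infty$ and $\operatorname{dist}_{U_n}(F_n(z),F_n(z'))\ne c(z,z')$ for all $n\ge1$. 3. (Eventually isometric) There is $N>0$ such that for every $(z,z')\in(U_0\times U_0)\setminus E$ there is $c(z,z')>0$ with $\operatorname{dist}_{U_n}(F_n(z),F_n(z'))=c(z,z')$ for all $n\ge N$. Moreover, for every $z\in U_0$: case 1 occurs if and only if $\sum_{n=1}^\infty(1-\lambda_n(z))=\infty$, and case 3 occurs if and only if $\lambda_n(z)=1$ for all sufficiently large $n$. -/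

import Mathlib

open Set Filter Topology

noncomputable section

namespace HyperbolicClassification

/-- A simply connected domain that is a proper subset of the complex plane. -/
structure IsProperSimplyConnectedDomain (U : Set ℂ) : Prop where
  isOpen : IsOpen U
  isSimplyConnected : IsSimplyConnected U
  ne_univ : U ≠ univ

/-- Hyperbolic density of the unit disc (curvature `-1`). -/
def discDensity (z : ℂ) : ℝ := 2 / (1 - ‖z‖ ^ 2)

/-- The pseudo-hyperbolic distance of the unit disc. -/
def discPseudoDist (z w : ℂ) : ℝ := ‖(z - w) / (1 - (starRingEnd ℂ) w * z)‖

/-- Hyperbolic distance of the unit disc, the distance induced by `discDensity`. -/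
def discDist (z w : ℂ) : ℝ := Real.log ((1 + discPseudoDist z w) / (1 - discPseudoDist z w))

/-- `φ` is a conformal bijection of `U` onto the unit disc. -/
def IsRiemannMap (U : Set ℂ) (φ : ℂ → ℂ) : Prop :=
  DifferentiableOn ℂ φ U ∧ BijOn φ U (Metric.ball 0 1)

open Classical in
/-- A conformal bijection of `U` onto the unit disc. It exists for every simply connected domain
`U ≠ ℂ`, and only then is this function used. -/
def riemannMap (U : Set ℂ) : ℂ → ℂ :=
  if h : ∃ φ, IsRiemannMap U φ then h.choose else 0

/-- Hyperbolic density of `U`: the pull-back of the density of the disc by a Riemann map. As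
conformal automorphisms of the disc are hyperbolic isometries, it does not depend on the choice of
the Riemann map. -/
def hypDensity (U : Set ℂ) (z : ℂ) : ℝ :=
  discDensity (riemannMap U z) * ‖deriv (riemannMap U) z‖

/-- Hyperbolic distance of `U`: the pull-back of the distance of the disc by a Riemann map. It does
not depend on the choice of the Riemann map. -/
def hypDist (U : Set ℂ) (z w : ℂ) : ℝ :=
  discDist (riemannMap U z) (riemannMap U w)

/-- Hyperbolic distortion at `z` of a holomorphic map `f : U → V`. It is also the limit of
`hypDist V (f z') (f z) / hypDist U z' z` as `z' → z`. -/
def hypDistortion (U V : Set ℂ) (f : ℂ → ℂ) (z : ℂ) : ℝ :=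
  hypDensity V (f z) * ‖deriv f z‖ / hypDensity U z

/-- The forward compositions `F n = f n ∘ ⋯ ∘ f 1`, with `F 0 = id`. (The map `f 0` is unused.) -/
def forwardComp (f : ℕ → ℂ → ℂ) : ℕ → ℂ → ℂ
  | 0 => id
  | n + 1 => f (n + 1) ∘ forwardComp f n

/-- The set of pairs of points of `U 0` whose orbits meet. -/
def mergeSet (U : ℕ → Set ℂ) (f : ℕ → ℂ → ℂ) : Set (ℂ × ℂ) :=
  {p | p ∈ U 0 ×ˢ U 0 ∧ ∃ n, 1 ≤ n ∧ forwardComp f n p.1 = forwardComp f n p.2}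

/-- Hyperbolic distance in `U n` between the `n`-th points of the orbits of `z` and `z'`. -/
def orbitDist (U : ℕ → Set ℂ) (f : ℕ → ℂ → ℂ) (n : ℕ) (z z' : ℂ) : ℝ :=
  hypDist (U n) (forwardComp f n z) (forwardComp f n z')

/-- For `n ≥ 1`, the hyperbolic distortion of `f n : U (n - 1) → U n` at `F (n - 1) z`. -/
def orbitDistortion (U : ℕ → Set ℂ) (f : ℕ → ℂ → ℂ) (n : ℕ) (z : ℂ) : ℝ :=
  hypDistortion (U (n - 1)) (U n) (f n) (forwardComp f (n - 1) z)

def IsContracting (U : ℕ → Set ℂ) (f : ℕ → ℂ → ℂ) : Prop :=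
  ∀ z ∈ U 0, ∀ z' ∈ U 0, Tendsto (fun n => orbitDist U f n z z') atTop (𝓝 0)

def IsSemiContracting (U : ℕ → Set ℂ) (f : ℕ → ℂ → ℂ) : Prop :=
  ∀ z z' : ℂ, (z, z') ∈ (U 0 ×ˢ U 0) \ mergeSet U f →
    ∃ c : ℝ, 0 < c ∧ Tendsto (fun n => orbitDist U f n z z') atTop (𝓝 c) ∧
      ∀ n, 1 ≤ n → orbitDist U f n z z' ≠ c

def IsEventuallyIsometric (U : ℕ → Set ℂ) (f : ℕ → ℂ → ℂ) : Prop :=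
  ∃ N : ℕ, 0 < N ∧ ∀ z z' : ℂ, (z, z') ∈ (U 0 ×ˢ U 0) \ mergeSet U f →
    ∃ c : ℝ, 0 < c ∧ ∀ n, N ≤ n → orbitDist U f n z z' = c

end HyperbolicClassification

end

/-! Everything is done with the pseudo-hyperbolic distance, of which the hyperbolic distance is a
strictly increasing continuous function. Transporting `f_n` to the disc by Riemann maps centred at
`F_{n-1}(z)` and `F_n(z)` gives a self-map `h` of the disc with `h(0) = 0` and `|h'(0)| = λ_n(z)`.
Schwarz–Pick for `h(w)/w` then bounds the distance after one step from both sides: it is the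
previous distance times `1 - O(1 - λ_n(z))`, and at most that distance times `1 - c(1 - λ_n(z))`
with `c > 0` (`hypPseudoDist_map_bounds`). As distances never increase, the constants are uniform
along a pair of orbits.

Iterating, a divergent series `∑(1 - λ_n(z))` forces the distance to `0`, while a convergent one
keeps it away from `0` for orbits that never merge (`tendsto_zero_of_le_mul`,
`exists_pos_le_of_mul_le`). Equality in Schwarz–Pick for one pair of distinct points means
distortion `1` everywhere, so a non-merging pair attains its positive limit only if all later maps
are isometries. Each `z` has a partner outside `E`, since fibres of the non-constant maps `F_n` are
countable; this makes the cases exclusive and links each criterion to its case.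

The Riemann mapping theorem, needed to make the chosen Riemann maps meaningful, is proved by Koebe's
extremal argument. -/

namespace HyperbolicClassification

/-! ### Disc automorphisms and the pseudo-hyperbolic distance -/

/-- The disc automorphism sending `c` to `0`. -/
noncomputable def moebius (c z : ℂ) : ℂ := (z - c) / (1 - (starRingEnd ℂ) c * z)

lemma discPseudoDist_eq_norm_moebius (z w : ℂ) : discPseudoDist z w = ‖moebius w z‖ := rfl

@[simp] lemma moebius_self (c : ℂ) : moebius c c = 0 := by simp [moebius]

lemma one_sub_conj_mul_ne_zero {c z : ℂ} (hc : ‖c‖ < 1) (hz : ‖z‖ < 1) :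
    1 - (starRingEnd ℂ) c * z ≠ 0 := by
  intro h
  have h1 : ‖(starRingEnd ℂ) c * z‖ = 1 := by rw [← sub_eq_zero.mp h]; simp
  rw [norm_mul, RCLike.norm_conj] at h1
  nlinarith [norm_nonneg c, norm_nonneg z]

lemma norm_sq_one_sub_conj_mul_sub (c z : ℂ) :
    ‖1 - (starRingEnd ℂ) c * z‖ ^ 2 - ‖z - c‖ ^ 2 = (1 - ‖c‖ ^ 2) * (1 - ‖z‖ ^ 2) := by
  simp only [Complex.sq_norm, Complex.normSq_apply, Complex.sub_re, Complex.sub_im, Complex.mul_re,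
    Complex.mul_im, Complex.conj_re, Complex.conj_im, Complex.one_re, Complex.one_im]
  ring

lemma one_sub_norm_moebius_sq {c z : ℂ} (hc : ‖c‖ < 1) (hz : ‖z‖ < 1) :
    1 - ‖moebius c z‖ ^ 2 =
      (1 - ‖c‖ ^ 2) * (1 - ‖z‖ ^ 2) / ‖1 - (starRingEnd ℂ) c * z‖ ^ 2 := by
  have h : ‖1 - (starRingEnd ℂ) c * z‖ ≠ 0 := norm_ne_zero_iff.mpr (one_sub_conj_mul_ne_zero hc hz)
  rw [← norm_sq_one_sub_conj_mul_sub, moebius, norm_div, div_pow, sub_div,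
    div_self (pow_ne_zero 2 h)]

lemma one_sub_norm_sq_pos {z : ℂ} (hz : ‖z‖ < 1) : 0 < 1 - ‖z‖ ^ 2 := by
  nlinarith [norm_nonneg z]

lemma norm_moebius_lt_one {c z : ℂ} (hc : ‖c‖ < 1) (hz : ‖z‖ < 1) : ‖moebius c z‖ < 1 := by
  have h := one_sub_norm_moebius_sq hc hz
  have h0 : 0 < ‖1 - (starRingEnd ℂ) c * z‖ := norm_pos_iff.mpr (one_sub_conj_mul_ne_zero hc hz)
  have h1 : 0 < 1 - ‖moebius c z‖ ^ 2 := by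
    rw [h]
    have := one_sub_norm_sq_pos hc
    have := one_sub_norm_sq_pos hz
    positivity
  nlinarith [norm_nonneg (moebius c z)]

lemma hasDerivAt_moebius {c z : ℂ} (hc : ‖c‖ < 1) (hz : ‖z‖ < 1) :
    HasDerivAt (moebius c) ((1 - ‖c‖ ^ 2 : ℝ) / (1 - (starRingEnd ℂ) c * z) ^ 2) z := by
  have h := one_sub_conj_mul_ne_zero hc hz
  have h1 : HasDerivAt (fun z : ℂ => 1 - (starRingEnd ℂ) c * z) (-(starRingEnd ℂ) c) z := by
    simpa using ((hasDerivAt_id z).const_mul ((starRingEnd ℂ) c)).const_sub 1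
  convert! ((hasDerivAt_id z).sub_const c).div h1 h using 1
  congr 1
  have h2 : (starRingEnd ℂ) c * c = ((‖c‖ ^ 2 : ℝ) : ℂ) := by
    rw [Complex.conj_mul']; push_cast; rfl
  push_cast at h2 ⊢
  simp only [id_eq]
  linear_combination h2

lemma differentiableOn_moebius {c : ℂ} (hc : ‖c‖ < 1) :
    DifferentiableOn ℂ (moebius c) (Metric.ball 0 1) := fun z hz =>
  (hasDerivAt_moebius hc (by simpa using hz)).differentiableAt.differentiableWithinAt

lemma mapsTo_moebius {c : ℂ} (hc : ‖c‖ < 1) :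
    MapsTo (moebius c) (Metric.ball 0 1) (Metric.ball 0 1) := fun z hz => by
  simpa using norm_moebius_lt_one hc (by simpa using hz)

lemma moebius_neg_moebius {c z : ℂ} (hc : ‖c‖ < 1) (hz : ‖z‖ < 1) :
    moebius (-c) (moebius c z) = z := by
  have h := one_sub_conj_mul_ne_zero hc hz
  have h' := one_sub_conj_mul_ne_zero hc hc
  have h2 := one_sub_conj_mul_ne_zero (c := -c) (by simpa using hc) (norm_moebius_lt_one hc hz)
  unfold moebius at h2 ⊢
  rw [div_eq_iff h2]
  simp only [map_neg]
  generalize (starRingEnd ℂ) c = d at h ⊢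
  rw [mul_div_assoc', sub_neg_eq_add, div_add' _ _ _ h, eq_comm, mul_sub, mul_div_assoc',
    sub_div' h]
  congr 1
  ring

lemma bijOn_moebius {c : ℂ} (hc : ‖c‖ < 1) :
    BijOn (moebius c) (Metric.ball 0 1) (Metric.ball 0 1) := by
  have hc' : ‖-c‖ < 1 := by simpa using hc
  refine InvOn.bijOn (f' := moebius (-c)) ⟨fun z hz => ?_, fun z hz => ?_⟩ (mapsTo_moebius hc)
    (mapsTo_moebius hc')
  · exact moebius_neg_moebius hc (by simpa using hz)
  · simpa using moebius_neg_moebius hc' (z := z) (by simpa using hz)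

/-- Disc automorphisms preserve the hyperbolic derivative of a map into the disc. -/
lemma discDensity_moebius_mul_norm_deriv {g : ℂ → ℂ} {a c : ℂ} (hc : ‖c‖ < 1)
    (hg : DifferentiableAt ℂ g a) (ha : ‖g a‖ < 1) :
    discDensity (moebius c (g a)) * ‖deriv (moebius c ∘ g) a‖ = discDensity (g a) * ‖deriv g a‖ := by
  have hd := (hasDerivAt_moebius hc ha).comp a hg.hasDerivAt
  have h : ‖1 - (starRingEnd ℂ) c * g a‖ ≠ 0 :=
    norm_ne_zero_iff.mpr (one_sub_conj_mul_ne_zero hc ha)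
  have h1 := (one_sub_norm_sq_pos hc).ne'
  have h2 := (one_sub_norm_sq_pos ha).ne'
  rw [hd.deriv, discDensity, discDensity, one_sub_norm_moebius_sq hc ha, norm_mul, norm_div,
    norm_pow, Complex.norm_real, Real.norm_of_nonneg (one_sub_norm_sq_pos hc).le]
  field_simp

lemma discPseudoDist_comm (z w : ℂ) : discPseudoDist z w = discPseudoDist w z := by
  rw [discPseudoDist, discPseudoDist, norm_div, norm_div, norm_sub_rev,
    ← RCLike.norm_conj (1 - (starRingEnd ℂ) w * z)]
  simp [mul_comm]

lemma discPseudoDist_lt_one {z w : ℂ} (hz : ‖z‖ < 1) (hw : ‖w‖ < 1) : discPseudoDist z w < 1 :=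
  norm_moebius_lt_one hw hz

lemma discPseudoDist_nonneg (z w : ℂ) : 0 ≤ discPseudoDist z w := norm_nonneg _

lemma discPseudoDist_eq_zero_iff {z w : ℂ} (hz : ‖z‖ < 1) (hw : ‖w‖ < 1) :
    discPseudoDist z w = 0 ↔ z = w := by
  rw [discPseudoDist, norm_eq_zero, div_eq_zero_iff,
    or_iff_left (one_sub_conj_mul_ne_zero hw hz), sub_eq_zero]

/-- With the moduli fixed, `1 - discPseudoDist z w ^ 2` is largest when the denominator `‖1 - conj w
* z‖` is smallest, and that is at least `1 - ‖w‖ * ‖z‖`. So rotating both points onto one ray cannot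
increase their distance. -/
lemma abs_norm_sub_norm_le {z w : ℂ} (hz : ‖z‖ < 1) (hw : ‖w‖ < 1) :
    |‖z‖ - ‖w‖| ≤ discPseudoDist z w * (1 - ‖w‖ * ‖z‖) := by
  have h0 : 0 < 1 - ‖w‖ * ‖z‖ := by nlinarith [norm_nonneg z, norm_nonneg w]
  have h1 : 1 - ‖w‖ * ‖z‖ ≤ ‖1 - (starRingEnd ℂ) w * z‖ := by
    simpa using norm_sub_norm_le (1 : ℂ) ((starRingEnd ℂ) w * z)
  have h2 := one_sub_norm_moebius_sq hw hz
  rw [← discPseudoDist_eq_norm_moebius] at h2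
  have h3 : (1 - ‖w‖ ^ 2) * (1 - ‖z‖ ^ 2) / ‖1 - (starRingEnd ℂ) w * z‖ ^ 2 ≤
      (1 - ‖w‖ ^ 2) * (1 - ‖z‖ ^ 2) / (1 - ‖w‖ * ‖z‖) ^ 2 := by
    have := one_sub_norm_sq_pos hz
    have := one_sub_norm_sq_pos hw
    gcongr
  rw [← h2, le_div_iff₀ (by positivity)] at h3
  apply abs_le_of_sq_le_sq _ (mul_nonneg (discPseudoDist_nonneg _ _) h0.le)
  nlinarith

/-! ### Quantitative Schwarz–Pick in the disc -/

/-- The **Schwarz–Pick lemma** with respect to the origin. -/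
lemma discPseudoDist_map_zero_le {q : ℂ → ℂ} (hq : DifferentiableOn ℂ q (Metric.ball 0 1))
    (hm : MapsTo q (Metric.ball 0 1) (Metric.ball 0 1)) {z : ℂ} (hz : ‖z‖ < 1) :
    discPseudoDist (q z) (q 0) ≤ ‖z‖ := by
  have h0 : ‖q 0‖ < 1 := by simpa using hm (Metric.mem_ball_self one_pos)
  exact Complex.norm_le_norm_of_mapsTo_ball (R := 1) (f := moebius (q 0) ∘ q)
    ((differentiableOn_moebius h0).comp hq hm)
    (((mapsTo_moebius h0).comp hm).mono_right Metric.ball_subset_closedBall) (by simp) hz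

/-- The closed disc is allowed because the intended `q` is `h(w)/w`, a unimodular constant when `h`
is a rotation. If modulus `1` is attained, the maximum principle makes `q` constant; otherwise
Schwarz–Pick applies. -/
lemma abs_norm_sub_norm_le_of_mapsTo_closedBall {q : ℂ → ℂ}
    (hq : DifferentiableOn ℂ q (Metric.ball 0 1))
    (hm : ∀ z : ℂ, ‖z‖ < 1 → ‖q z‖ ≤ 1) {z : ℂ} (hz : ‖z‖ < 1) :
    |‖q z‖ - ‖q 0‖| ≤ ‖z‖ * (1 - ‖q 0‖ * ‖q z‖) := by
  by_cases hone : ∃ w : ℂ, ‖w‖ < 1 ∧ ‖q w‖ = 1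
  · obtain ⟨w, hw, hqw⟩ := hone
    have hc := Complex.eqOn_of_isPreconnected_of_isMaxOn_norm
      (convex_ball (0 : ℂ) 1).isPreconnected Metric.isOpen_ball hq (c := w) (by simpa using hw)
      (fun x hx => by simpa [hqw] using hm x (by simpa using hx))
    have h1 : q z = q w := hc (by simpa using hz)
    have h2 : q 0 = q w := hc (Metric.mem_ball_self one_pos)
    simp [h1, h2, hqw]
  · push Not at hone
    have hlt : ∀ w : ℂ, ‖w‖ < 1 → ‖q w‖ < 1 := fun w hw => (hm w hw).lt_of_ne (hone w hw)
    have h1 := hlt z hz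
    have h0 := hlt 0 (by simp)
    refine (abs_norm_sub_norm_le h1 h0).trans ?_
    gcongr
    · nlinarith [norm_nonneg (q z), norm_nonneg (q 0)]
    · exact discPseudoDist_map_zero_le hq (fun w hw => by simpa using hlt w (by simpa using hw)) hz

/-- Two-sided bounds refining the Schwarz lemma in terms of the derivative at the origin. -/
lemma norm_bounds_of_mapsTo_ball {h : ℂ → ℂ} (hd : DifferentiableOn ℂ h (Metric.ball 0 1))
    (hm : MapsTo h (Metric.ball 0 1) (Metric.ball 0 1)) (h0 : h 0 = 0) {z : ℂ} (hz : ‖z‖ < 1) :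
    ‖deriv h 0‖ ≤ 1 ∧
    ‖h z‖ ≤ ‖z‖ * (1 - (1 - ‖z‖) * (1 - ‖deriv h 0‖) / 2) ∧
    ‖z‖ * (1 - 2 * (1 - ‖deriv h 0‖) / (1 - ‖z‖)) ≤ ‖h z‖ := by
  have hm' : MapsTo h (Metric.ball 0 1) (Metric.closedBall (h 0) 1) := by
    rw [h0]; exact hm.mono_right Metric.ball_subset_closedBall
  have hq : ∀ w : ℂ, ‖w‖ < 1 → ‖dslope h 0 w‖ ≤ 1 := fun w hw => by
    simpa using Complex.norm_dslope_le_div_of_mapsTo_ball hd hm' (by simpa using hw)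
  have hdq : DifferentiableOn ℂ (dslope h 0) (Metric.ball 0 1) :=
    (Complex.differentiableOn_dslope (Metric.ball_mem_nhds _ one_pos)).mpr hd
  have key := abs_norm_sub_norm_le_of_mapsTo_closedBall hdq hq hz
  have hl := hq 0 (by simp)
  have hs := hq z hz
  have heq : ‖h z‖ = ‖z‖ * ‖dslope h 0 z‖ := by
    have := sub_smul_dslope h 0 z
    rw [sub_zero, h0, sub_zero, smul_eq_mul] at this
    rw [← this, norm_mul]
  simp only [dslope_same] at key hl
  rw [abs_le] at key
  set s := ‖dslope h 0 z‖
  set l := ‖deriv h 0‖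
  set r := ‖z‖
  have hr : 0 ≤ r := norm_nonneg _
  have hl0 : 0 ≤ l := norm_nonneg _
  have hs0 : 0 ≤ s := norm_nonneg _
  refine ⟨hl, ?_, ?_⟩
  · rw [heq]
    refine mul_le_mul_of_nonneg_left ?_ hr
    -- This gives `1 - s ≥ (1 - l)(1 - r)/(1 + r l)`, and `1 + r l ≤ 2`.
    have : s * (1 + r * l) ≤ l + r := by linarith [key.2]
    nlinarith [mul_nonneg hr hl0, mul_nonneg (sub_nonneg.2 hl) (sub_nonneg.2 hz.le),
      mul_le_one₀ hz.le hl0 hl,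
      mul_nonneg (mul_nonneg (sub_nonneg.2 hl) (sub_nonneg.2 hz.le))
        (sub_nonneg.2 (mul_le_one₀ hz.le hl0 hl))]
  · rw [heq]
    refine mul_le_mul_of_nonneg_left ?_ hr
    have h1 : 0 < 1 - r := by linarith
    rw [sub_le_comm, le_div_iff₀ h1]
    -- This gives `1 - s ≤ (1 - l)(1 + r)/(1 - r l)`, and `1 + r ≤ 2`, `1 - r l ≥ 1 - r`.
    have : l - r ≤ s * (1 - r * l) := by linarith [key.1]
    nlinarith [mul_nonneg hr (sub_nonneg.2 hl),
      mul_nonneg (sub_nonneg.2 hs) (mul_nonneg hr (sub_nonneg.2 hl)), mul_nonneg hr hl0]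

/-! ### Injective holomorphic maps, their inverses and their limits -/

lemma analyticOnNhd_of_differentiableOn {f : ℂ → ℂ} {U : Set ℂ} (hU : IsOpen U)
    (hf : DifferentiableOn ℂ f U) : AnalyticOnNhd ℂ f U := fun _ hz =>
  hf.analyticAt (hU.mem_nhds hz)

lemma not_eventually_eq_of_injOn {φ : ℂ → ℂ} {U : Set ℂ} {a : ℂ} (hU : U ∈ 𝓝 a)
    (hinj : InjOn φ U) : ¬ ∀ᶠ z in 𝓝 a, φ z = φ a := by
  intro h
  have h1 : ∀ᶠ z in 𝓝[≠] a, False := by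
    filter_upwards [nhdsWithin_le_nhds h, nhdsWithin_le_nhds hU, self_mem_nhdsWithin]
      with z hz hzU hne
    exact hne (hinj hzU (mem_of_mem_nhds hU) hz)
  exact h1.exists.elim fun _ h => h

lemma nhds_le_map_nhds_of_injOn {φ : ℂ → ℂ} {U : Set ℂ} {a : ℂ} (hU : U ∈ 𝓝 a)
    (hφ : DifferentiableOn ℂ φ U) (hinj : InjOn φ U) : 𝓝 (φ a) ≤ map φ (𝓝 a) :=
  (hφ.analyticAt hU).eventually_constant_or_nhds_le_map_nhds.resolve_left
    (not_eventually_eq_of_injOn hU hinj)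

lemma continuousAt_invFunOn {φ : ℂ → ℂ} {U : Set ℂ} (hU : IsOpen U)
    (hφ : DifferentiableOn ℂ φ U) (hinj : InjOn φ U) {a : ℂ} (ha : a ∈ U) :
    ContinuousAt (Function.invFunOn φ U) (φ a) := by
  rw [ContinuousAt, hinj.leftInvOn_invFunOn ha]
  intro V hV
  have h := nhds_le_map_nhds_of_injOn (hU.mem_nhds ha) hφ hinj
    (image_mem_map (inter_mem hV (hU.mem_nhds ha)))
  rw [mem_map]
  filter_upwards [h]
  rintro _ ⟨z, ⟨hzV, hzU⟩, rfl⟩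
  rwa [mem_preimage, hinj.leftInvOn_invFunOn hzU]

lemma isOpen_image_of_injOn {φ : ℂ → ℂ} {U : Set ℂ} (hU : IsOpen U)
    (hφ : DifferentiableOn ℂ φ U) (hinj : InjOn φ U) : IsOpen (φ '' U) := by
  rw [isOpen_iff_mem_nhds]
  rintro _ ⟨z, hz, rfl⟩
  exact nhds_le_map_nhds_of_injOn (hU.mem_nhds hz) hφ hinj (image_mem_map (hU.mem_nhds hz))

lemma eventually_deriv_ne_zero_of_injOn {φ : ℂ → ℂ} {U : Set ℂ} (hU : IsOpen U)
    (hφ : DifferentiableOn ℂ φ U) (hinj : InjOn φ U) {a : ℂ} (ha : a ∈ U) :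
    ∀ᶠ z in 𝓝[≠] a, deriv φ z ≠ 0 := by
  refine (hφ.analyticAt (hU.mem_nhds ha)).deriv.eventually_eq_zero_or_eventually_ne_zero.resolve_left
    fun h => not_eventually_eq_of_injOn (hU.mem_nhds ha) hinj ?_
  obtain ⟨r, hr, hball⟩ := Metric.mem_nhds_iff.mp (inter_mem h (hU.mem_nhds ha))
  filter_upwards [Metric.ball_mem_nhds a hr] with z hz
  exact Metric.isOpen_ball.is_const_of_deriv_eq_zero (convex_ball a r).isPreconnected
    (hφ.mono fun x hx => (hball hx).2) (fun x hx => (hball hx).1) hz (Metric.mem_ball_self hr)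

/-- The inverse of an injective holomorphic map is holomorphic. -/
lemma differentiableOn_invFunOn {φ : ℂ → ℂ} {U : Set ℂ} (hU : IsOpen U)
    (hφ : DifferentiableOn ℂ φ U) (hinj : InjOn φ U) :
    DifferentiableOn ℂ (Function.invFunOn φ U) (φ '' U) := by
  rintro _ ⟨a, ha, rfl⟩
  -- Near `φ a`, but off it, the derivative of `φ` at the preimage is non-zero and the inverse
  -- function rule applies; continuity removes the singularity at `φ a`.
  refine (Complex.analyticAt_of_differentiable_on_punctured_nhds_of_continuousAt ?_
    (continuousAt_invFunOn hU hφ hinj ha)).differentiableAt.differentiableWithinAt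
  have h1 := eventually_nhdsWithin_iff.mp (eventually_deriv_ne_zero_of_injOn hU hφ hinj ha)
  have h2 := nhds_le_map_nhds_of_injOn (hU.mem_nhds ha) hφ hinj
    (image_mem_map (inter_mem h1 (hU.mem_nhds ha)))
  filter_upwards [nhdsWithin_le_nhds h2, self_mem_nhdsWithin]
  rintro _ ⟨z, ⟨hz, hzU⟩, rfl⟩ hne
  have hz' : deriv φ z ≠ 0 := hz fun h => hne (by simp_all)
  refine (HasDerivAt.of_local_left_inverse (f := φ) (f' := deriv φ z)
    (continuousAt_invFunOn hU hφ hinj hzU) ?_ hz' ?_).differentiableAt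
  · rw [hinj.leftInvOn_invFunOn hzU]
    exact (hφ.differentiableAt (hU.mem_nhds hzU)).hasDerivAt
  · filter_upwards [(isOpen_image_of_injOn hU hφ hinj).mem_nhds (mem_image_of_mem φ hzU)] with y hy
    exact Function.invFunOn_eq hy

/-- The inverse is already known to be holomorphic, so the chain rule writes `1` as a multiple of
`deriv φ a`. -/
lemma deriv_ne_zero_of_injOn {φ : ℂ → ℂ} {U : Set ℂ} (hU : IsOpen U)
    (hφ : DifferentiableOn ℂ φ U) (hinj : InjOn φ U) {a : ℂ} (ha : a ∈ U) : deriv φ a ≠ 0 := by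
  intro h0
  have h1 := ((differentiableOn_invFunOn hU hφ hinj).differentiableAt
    ((isOpen_image_of_injOn hU hφ hinj).mem_nhds (mem_image_of_mem φ ha))).hasDerivAt.comp a
    (hφ.differentiableAt (hU.mem_nhds ha)).hasDerivAt
  have h2 : HasDerivAt (Function.invFunOn φ U ∘ φ) 1 a := by
    refine (hasDerivAt_id a).congr_of_eventuallyEq ?_
    filter_upwards [hU.mem_nhds ha] with z hz
    exact hinj.leftInvOn_invFunOn hz
  have := h1.unique h2
  simp [h0] at this

/-- **Hurwitz's theorem**: a locally uniform limit of injective holomorphic functions on a domain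
is injective or constant. -/
lemma injOn_or_const_of_tendstoLocallyUniformlyOn {ι : Type*} {p : Filter ι} [p.NeBot]
    {F : ι → ℂ → ℂ} {f : ℂ → ℂ} {U : Set ℂ} (hU : IsOpen U) (hc : IsPreconnected U)
    (hF : ∀ᶠ n in p, DifferentiableOn ℂ (F n) U) (hinj : ∀ᶠ n in p, InjOn (F n) U)
    (h : TendstoLocallyUniformlyOn F f p U) :
    InjOn f U ∨ ∀ x ∈ U, ∀ y ∈ U, f x = f y := by
  refine or_iff_not_imp_right.mpr fun hnc a ha b hb hab => ?_
  by_contra hne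
  have hf : AnalyticOnNhd ℂ f U := analyticOnNhd_of_differentiableOn hU (h.differentiableOn hF hU)
  have h1 : ∀ᶠ z in 𝓝[≠] a, f z ≠ f a := by
    refine ((hf a ha).eventually_eq_or_eventually_ne analyticAt_const).resolve_left fun h => hnc ?_
    have := hf.eqOn_of_preconnected_of_eventuallyEq analyticOnNhd_const hc ha h
    intro x hx y hy
    rw [this hx, this hy]
  have h2 := inter_mem (eventually_nhdsWithin_iff.mp h1)
    (inter_mem (hU.mem_nhds ha) (isOpen_ne.mem_nhds hne))
  obtain ⟨r, hr, hball⟩ := Metric.nhds_basis_closedBall.mem_iff.mp h2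
  have hUr : Metric.closedBall a r ⊆ U := fun z hz => (hball hz).2.1
  obtain ⟨w, hw, hmin⟩ := (isCompact_sphere a r).exists_isMinOn
    (NormedSpace.sphere_nonempty.mpr hr.le) (f := fun z => ‖f z - f a‖)
    (((hf.continuousOn.mono (Metric.sphere_subset_closedBall.trans hUr)).sub
      continuousOn_const).norm)
  set m := ‖f w - f a‖
  have hm : 0 < m := by
    refine norm_pos_iff.mpr (sub_ne_zero.mpr ((hball (Metric.sphere_subset_closedBall hw)).1 ?_))
    rintro rfl
    simp [hr.ne] at hw
  have hK := (tendstoLocallyUniformlyOn_iff_forall_isCompact hU).mp h _ hUr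
    (isCompact_closedBall a r)
  have e1 := Metric.tendstoUniformlyOn_iff.mp hK (m / 8) (by positivity)
  have e2 := Metric.tendsto_nhds.mp (h.tendsto_at hb) (m / 8) (by positivity)
  obtain ⟨n, hn1, hn2, hnF, hni⟩ := (e1.and (e2.and (hF.and hinj))).exists
  have haa := hn1 a (Metric.mem_closedBall_self hr.le)
  -- On the sphere `F n` stays at least `m - 2(m/8) ≥ m/2` from `F n a`, so a quantitative open
  -- mapping theorem puts the ball of radius `m/4` about `F n a` in the image of the closed ball. It
  -- contains `F n b`, although `b` lies outside the closed ball.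
  have hball2 := DiffContOnCl.ball_subset_image_closedBall (f := F n) (z₀ := a) (ε := m / 2)
    ((hnF.mono hUr).diffContOnCl_ball Subset.rfl) hr ?_ ?_
  · have hmem : F n b ∈ Metric.ball (F n a) (m / 2 / 2) := by
      rw [Metric.mem_ball]
      have t1 := dist_triangle (F n b) (f b) (F n a)
      rw [← hab] at t1 hn2
      linarith
    obtain ⟨x, hx, hxb⟩ := hball2 hmem
    have := hni (hUr hx) hb hxb
    subst this
    exact (hball hx).2.2 rfl
  · intro z hz
    have hzz := hn1 z (Metric.sphere_subset_closedBall hz)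
    have hzm : m ≤ dist (f z) (f a) := by rw [dist_eq_norm]; exact hmin hz
    have t1 := dist_triangle4 (f z) (F n z) (F n a) (f a)
    rw [dist_comm (F n a)] at t1
    rw [← dist_eq_norm]
    linarith
  · exact not_eventually.mp (not_eventually_eq_of_injOn (hU.mem_nhds ha) hni)

/-! ### A compact family and its extremal problem -/

section Extremal

variable {U : Set ℂ}

/-- Extension by zero of a continuous function on `U`. -/
noncomputable def zeroExtend (f : C(U, ℂ)) : ℂ → ℂ := Function.extend (↑) f 0

@[simp] lemma zeroExtend_coe (f : C(U, ℂ)) (x : U) : zeroExtend f x = f x :=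
  Subtype.val_injective.extend_apply _ _ _

/-- Holomorphic functions on `U` bounded by `1` that are injective or constant. -/
def injOrConstFamily (U : Set ℂ) : Set C(U, ℂ) :=
  {f | DifferentiableOn ℂ (zeroExtend f) U ∧ (∀ x, ‖f x‖ ≤ 1) ∧
    (Function.Injective f ∨ ∀ x y, f x = f y)}

lemma injOn_zeroExtend {f : C(U, ℂ)} (hf : Function.Injective f) : InjOn (zeroExtend f) U :=
  fun x hx y hy h => by
    have : f ⟨x, hx⟩ = f ⟨y, hy⟩ := by simpa [← zeroExtend_coe] using h
    exact congrArg Subtype.val (hf this)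

lemma tendstoLocallyUniformlyOn_zeroExtend (hU : IsOpen U) {p : Filter C(U, ℂ)} {f : C(U, ℂ)}
    (hp : p ≤ 𝓝 f) : TendstoLocallyUniformlyOn zeroExtend (zeroExtend f) p U := by
  have := hU.locallyCompactSpace
  rw [tendstoLocallyUniformlyOn_iff_tendstoLocallyUniformly_comp_coe]
  have h := ContinuousMap.tendsto_iff_tendstoLocallyUniformly.mp (tendsto_id.mono_left hp)
  have h2 : zeroExtend f ∘ (↑) = (f : U → ℂ) := funext fun x => zeroExtend_coe f x
  rw [h2]
  simpa using h

/-- Along an ultrafilter one of the two alternatives holds eventually: injectivity passes to the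
limit by Hurwitz, up to degeneration to a constant, and constancy passes pointwise. -/
lemma isClosed_injOrConstFamily (hU : IsOpen U) (hc : IsPreconnected U) :
    IsClosed (injOrConstFamily U) := by
  rw [isClosed_iff_ultrafilter]
  intro f u hu hS
  have hlim := tendstoLocallyUniformlyOn_zeroExtend hU hu
  have hd : ∀ᶠ g in (u : Filter C(U, ℂ)), DifferentiableOn ℂ (zeroExtend g) U :=
    mem_of_superset hS fun g hg => hg.1
  have hpt : ∀ x : U, Tendsto (fun g : C(U, ℂ) => g x) u (𝓝 (f x)) := fun x => by
    simpa using hlim.tendsto_at x.2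
  refine ⟨hlim.differentiableOn hd hU, fun x => ?_, ?_⟩
  · exact le_of_tendsto (hpt x).norm (mem_of_superset hS fun g hg => hg.2.1 x)
  · have hor : ∀ᶠ g : C(U, ℂ) in (u : Filter C(U, ℂ)),
        (Function.Injective fun x : U => g x) ∨ ∀ x y : U, g x = g y :=
      mem_of_superset hS fun g hg => hg.2.2
    rcases Ultrafilter.eventually_or.mp hor with h | h
    · rcases injOn_or_const_of_tendstoLocallyUniformlyOn hU hc hd
        (h.mono fun g hg => injOn_zeroExtend hg) hlim with h | h
      · left
        intro x y hxy
        exact Subtype.ext (h x.2 y.2 (by simpa using hxy))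
      · right
        intro x y
        simpa using h x x.2 y y.2
    · right
      intro x y
      exact tendsto_nhds_unique ((hpt x).congr' (h.mono fun g hg => hg x y)) (hpt y)

lemma equicontinuous_injOrConstFamily (hU : IsOpen U) :
    Equicontinuous (fun f : injOrConstFamily U => ((f : C(U, ℂ)) : U → ℂ)) := by
  intro x
  obtain ⟨r, hr, hball⟩ := Metric.isOpen_iff.mp hU x x.2
  -- Every member maps the ball of radius `r` about `x` into the closed ball of radius `2` about its
  -- value at `x`, so the Schwarz lemma gives a common Lipschitz bound at `x`.
  refine Metric.equicontinuousAt_of_continuity_modulus (fun y => 2 / r * dist y x) ?_ _ ?_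
  · have : Continuous fun y : U => 2 / r * dist y x := by fun_prop
    simpa using this.tendsto x
  · filter_upwards [Metric.ball_mem_nhds x hr] with y hy f
    have := Complex.dist_le_div_mul_dist_of_mapsTo_ball (f := zeroExtend f.1) (c := (x : ℂ))
      (z := (y : ℂ)) (R₁ := r) (R₂ := 2) (f.2.1.mono hball) (fun z hz => ?_) hy
    · rw [dist_comm, Subtype.dist_eq]
      simpa using this
    · have h1 := f.2.2.1 ⟨z, hball hz⟩
      have h2 := f.2.2.1 x
      rw [← zeroExtend_coe] at h1 h2
      rw [mem_closedBall_iff_norm]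
      exact (norm_sub_le _ _).trans (by linarith)

lemma isCompact_injOrConstFamily (hU : IsOpen U) (hc : IsPreconnected U) :
    IsCompact (injOrConstFamily U) := by
  have := hU.locallyCompactSpace
  have : T2Space (UniformOnFun U ℂ {K | IsCompact K}) :=
    UniformOnFun.t2Space_of_covering (eq_univ_of_forall fun x =>
      mem_sUnion_of_mem (mem_singleton x) isCompact_singleton)
  have h := ArzelaAscoli.isCompact_closure_of_isClosedEmbedding (ι := C(U, ℂ)) (X := U) (α := ℂ)
    (𝔖 := {K | IsCompact K}) (F := fun f => f) (fun K hK => hK)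
    ContinuousMap.isUniformEmbedding_toUniformOnFunIsCompact.isClosedEmbedding
    (s := injOrConstFamily U)
    (fun K _ => (equicontinuous_injOrConstFamily hU).equicontinuousOn K)
    (fun K _ x _ => ⟨Metric.closedBall 0 1, isCompact_closedBall 0 1, fun f hf => by
      simpa using hf.2.1 x⟩)
  rwa [(isClosed_injOrConstFamily hU hc).closure_eq] at h

lemma continuousOn_deriv_zeroExtend (hU : IsOpen U) {z : ℂ} (hz : z ∈ U) :
    ContinuousOn (fun f : C(U, ℂ) => deriv (zeroExtend f) z) (injOrConstFamily U) := fun _ _ =>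
  ((tendstoLocallyUniformlyOn_zeroExtend hU nhdsWithin_le_nhds).deriv
    (mem_of_superset self_mem_nhdsWithin fun _ hg => hg.1) hU).tendsto_at hz

lemma exists_norm_deriv_maximal (hU : IsOpen U) (hc : IsPreconnected U) {z₀ : ℂ} (hz₀ : z₀ ∈ U)
    (hne : ∃ f : ℂ → ℂ, DifferentiableOn ℂ f U ∧ MapsTo f U (Metric.ball 0 1) ∧ InjOn f U) :
    ∃ g : ℂ → ℂ, DifferentiableOn ℂ g U ∧ MapsTo g U (Metric.ball 0 1) ∧ InjOn g U ∧
      ∀ f : ℂ → ℂ, DifferentiableOn ℂ f U → MapsTo f U (Metric.ball 0 1) → InjOn f U →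
        ‖deriv f z₀‖ ≤ ‖deriv g z₀‖ := by
  have lift : ∀ f : ℂ → ℂ, DifferentiableOn ℂ f U → MapsTo f U (Metric.ball 0 1) → InjOn f U →
      ∃ F ∈ injOrConstFamily U, deriv (zeroExtend F) z₀ = deriv f z₀ := by
    intro f hd hm hi
    let F : C(U, ℂ) := ⟨fun x => f x, hd.continuousOn.comp_continuous continuous_subtype_val
      fun x => x.2⟩
    have heq : EqOn (zeroExtend F) f U := fun x hx => zeroExtend_coe F ⟨x, hx⟩
    refine ⟨F, ⟨hd.congr heq, fun x => ?_, Or.inl fun x y h => Subtype.ext (hi x.2 y.2 h)⟩, ?_⟩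
    · have : ‖f x‖ < 1 := by simpa using hm x.2
      exact this.le
    · exact (heq.eventuallyEq_of_mem (hU.mem_nhds hz₀)).deriv_eq
  obtain ⟨f₀, hd₀, hm₀, hi₀⟩ := hne
  obtain ⟨F₀, hF₀, hF₀d⟩ := lift f₀ hd₀ hm₀ hi₀
  obtain ⟨G, hG, hmax⟩ := (isCompact_injOrConstFamily hU hc).exists_isMaxOn ⟨F₀, hF₀⟩
    (continuousOn_deriv_zeroExtend hU hz₀).norm
  have hmax' : ∀ f : ℂ → ℂ, DifferentiableOn ℂ f U → MapsTo f U (Metric.ball 0 1) → InjOn f U →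
        ‖deriv f z₀‖ ≤ ‖deriv (zeroExtend G) z₀‖ := fun f hd hm hi => by
    obtain ⟨F, hF, hFd⟩ := lift f hd hm hi
    rw [← hFd]
    exact hmax hF
  -- A maximiser with non-zero derivative cannot be a constant member; this is where the existence
  -- of one injective map is needed.
  have hpos : deriv (zeroExtend G) z₀ ≠ 0 := fun h => by
    have := hmax' f₀ hd₀ hm₀ hi₀
    rw [h, norm_zero, norm_le_zero_iff] at this
    exact deriv_ne_zero_of_injOn hU hd₀ hi₀ hz₀ this
  have hinj : InjOn (zeroExtend G) U := by
    refine injOn_zeroExtend (hG.2.2.resolve_right fun h => hpos ?_)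
    have : zeroExtend G =ᶠ[𝓝 z₀] fun _ => G ⟨z₀, hz₀⟩ := by
      filter_upwards [hU.mem_nhds hz₀] with x hx
      exact (zeroExtend_coe G ⟨x, hx⟩).trans (h _ _)
    rw [this.deriv_eq, deriv_const]
  refine ⟨zeroExtend G, hG.1, ?_, hinj, hmax'⟩
  -- The image is open, so lying in the closed disc already puts it in the open one.
  have hsub : zeroExtend G '' U ⊆ Metric.closedBall 0 1 := by
    rintro _ ⟨x, hx, rfl⟩
    simpa using! (zeroExtend_coe G ⟨x, hx⟩).symm ▸ hG.2.1 ⟨x, hx⟩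
  have := interior_maximal hsub (isOpen_image_of_injOn hU hG.1 hinj)
  rw [interior_closedBall _ one_ne_zero] at this
  exact mapsTo_iff_image_subset.mpr this

end Extremal

/-! ### The Riemann mapping theorem -/

lemma discDensity_pos {z : ℂ} (hz : ‖z‖ < 1) : 0 < discDensity z :=
  div_pos two_pos (one_sub_norm_sq_pos hz)

/-- Taking a square root increases the hyperbolic derivative. -/
lemma discDensity_mul_norm_deriv_lt_of_sq_eq {h k : ℂ → ℂ} {a : ℂ} (hk : DifferentiableAt ℂ k a)
    (hka : ‖k a‖ < 1) (hsq : ∀ z, k z ^ 2 = h z) (hne : deriv h a ≠ 0) :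
    discDensity (h a) * ‖deriv h a‖ < discDensity (k a) * ‖deriv k a‖ := by
  have hh : h = fun z => k z ^ 2 := funext fun z => (hsq z).symm
  have hd : deriv h a = 2 * k a * deriv k a := by
    rw [hh, deriv_fun_pow hk]
    simp
  have hk' : 0 < ‖deriv k a‖ := norm_pos_iff.mpr fun h0 => hne (by rw [hd, h0, mul_zero])
  have h1 := one_sub_norm_sq_pos hka
  have h2 : 0 < 1 - (‖k a‖ ^ 2) ^ 2 := by nlinarith
  rw [hd, ← hsq a, norm_mul, norm_mul, Complex.norm_two, ← mul_assoc]
  refine mul_lt_mul_of_pos_right ?_ hk'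
  rw [discDensity, discDensity, norm_pow, div_mul_eq_mul_div, div_lt_div_iff₀ h2 h1]
  -- With `t = ‖k a‖`, the claim is `2t(1 - t²) < 1 - t⁴`, whose two sides differ by `(1 - t²)(1 -
  -- t)²`.
  have : (‖k a‖ - 1) ^ 2 > 0 := by
    have : ‖k a‖ - 1 ≠ 0 := by linarith
    positivity
  nlinarith [mul_pos h1 this]

lemma differentiableOn_of_sq_eq {U : Set ℂ} {h k : ℂ → ℂ} (hU : IsOpen U)
    (hh : DifferentiableOn ℂ h U) (hk : ContinuousOn k U) (hsq : ∀ z, k z ^ 2 = h z)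
    (h0 : ∀ z ∈ U, h z ≠ 0) : DifferentiableOn ℂ k U := by
  intro z hz
  have hkz : k z + k z ≠ 0 := by
    rw [← two_mul]
    exact mul_ne_zero two_ne_zero fun h => h0 z hz (by rw [← hsq, h]; simp)
  have hlim : Tendsto (fun w => k w + k z) (𝓝 z) (𝓝 (k z + k z)) :=
    (hk.continuousAt (hU.mem_nhds hz)).add_const _
  refine (HasDerivAt.differentiableAt (f' := deriv h z / (k z + k z))
    (hasDerivAt_iff_tendsto_slope.mpr ?_)).differentiableWithinAt
  refine ((hasDerivAt_iff_tendsto_slope.mp (hh.differentiableAt (hU.mem_nhds hz)).hasDerivAt).div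
    (hlim.mono_left nhdsWithin_le_nhds) hkz).congr' ?_
  filter_upwards [nhdsWithin_le_nhds (hlim.eventually_ne hkz)] with w hw
  change slope h z w / (k w + k z) = slope k z w
  rw [div_eq_iff hw, slope_def_field, slope_def_field, ← hsq, ← hsq]
  ring

/-- A branch `k` of `√(z - a)` with `a ∉ U` is injective and never takes both a value and its
negative. Its image contains a ball about `k x`, so `k` avoids the opposite ball about `-k x`, and
inversion there gives a bounded injective map. -/
lemma exists_injOn_mapsTo_ball {U : Set ℂ} (hU : IsProperSimplyConnectedDomain U) :
    ∃ f : ℂ → ℂ, DifferentiableOn ℂ f U ∧ MapsTo f U (Metric.ball 0 1) ∧ InjOn f U := by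
  obtain ⟨a, ha⟩ := (ne_univ_iff_exists_notMem U).mp hU.ne_univ
  obtain ⟨x, hx⟩ := hU.isSimplyConnected.nonempty
  have hne : ∀ z ∈ U, z - a ≠ 0 := fun z hz h => ha (sub_eq_zero.mp h ▸ hz)
  obtain ⟨k, hkc, hk⟩ := Complex.exists_continuousOn_pow_eq hU.isSimplyConnected hU.isOpen
    (g := fun z => z - a) (by fun_prop) (by rintro ⟨z, hz, h⟩; exact hne z hz h) two_ne_zero
  have hkd := differentiableOn_of_sq_eq hU.isOpen (by fun_prop) hkc hk hne
  have hki : InjOn k U := fun z _ w _ h => by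
    have := hk z
    rw [h, hk w] at this
    exact (sub_left_injective this).symm
  obtain ⟨ε, hε, hball⟩ := Metric.isOpen_iff.mp (isOpen_image_of_injOn hU.isOpen hkd hki) (k x)
    (mem_image_of_mem k hx)
  have hfar : ∀ z ∈ U, ε ≤ ‖k z + k x‖ := by
    intro z hz
    by_contra! hlt
    obtain ⟨w, hw, hwz⟩ := hball (show -k z ∈ Metric.ball (k x) ε by
      rwa [Metric.mem_ball, dist_eq_norm, ← norm_neg, neg_sub, sub_neg_eq_add, add_comm])
    have h1 : w - a = z - a := by rw [← hk, ← hk, hwz, neg_sq]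
    rw [sub_left_injective h1] at hwz
    have h2 : k z = 0 := by linear_combination hwz / 2
    exact hne z hz (by rw [← hk, h2]; simp)
  have hnz : ∀ z ∈ U, k z + k x ≠ 0 := fun z hz => norm_pos_iff.mp (hε.trans_le (hfar z hz))
  refine ⟨fun z => (ε / 2 : ℝ) / (k z + k x), ?_, fun z hz => ?_, fun z hz w hw h => ?_⟩
  · exact (differentiableOn_const _).div (hkd.add_const _) hnz
  · rw [mem_ball_zero_iff, norm_div, Complex.norm_real, Real.norm_of_nonneg (by positivity),
      div_lt_one (norm_pos_iff.mpr (hnz z hz))]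
    linarith [hfar z hz]
  · have hε' : ((ε / 2 : ℝ) : ℂ) ≠ 0 := by exact_mod_cast (half_pos hε).ne'
    have h' := (div_eq_div_iff (hnz z hz) (hnz w hw)).mp h
    exact (hki hw hz (add_right_cancel (mul_left_cancel₀ hε' h'))).symm

/-- The **Riemann mapping theorem**. -/
theorem exists_isRiemannMap {U : Set ℂ} (hU : IsProperSimplyConnectedDomain U) :
    ∃ φ, IsRiemannMap U φ := by
  have hUo := hU.isOpen
  obtain ⟨z₀, hz₀⟩ := hU.isSimplyConnected.nonempty
  obtain ⟨g, hgd, hgm, hgi, hmax⟩ := exists_norm_deriv_maximal hUo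
    hU.isSimplyConnected.isPathConnected.isConnected.isPreconnected hz₀
    (exists_injOn_mapsTo_ball hU)
  refine ⟨g, hgd, hgm, hgi, fun c hc => ?_⟩
  by_contra hcg
  have hc1 : ‖c‖ < 1 := by simpa using hc
  have hlt : ∀ z ∈ U, ‖g z‖ < 1 := fun z hz => by simpa using hgm hz
  have hhd : DifferentiableOn ℂ (moebius c ∘ g) U := (differentiableOn_moebius hc1).comp hgd hgm
  have hhm : MapsTo (moebius c ∘ g) U (Metric.ball 0 1) := (mapsTo_moebius hc1).comp hgm
  have hhi : InjOn (moebius c ∘ g) U := (bijOn_moebius hc1).injOn.comp hgi hgm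
  have hh0 : 0 ∉ (moebius c ∘ g) '' U := by
    rintro ⟨z, hz, h0⟩
    have : discPseudoDist (g z) c = 0 := by
      rw [discPseudoDist_eq_norm_moebius]
      simpa using h0
    exact hcg ⟨z, hz, (discPseudoDist_eq_zero_iff (hlt z hz) hc1).mp this⟩
  -- Koebe's trick: an omitted value `c` allows a square root of `moebius c ∘ g`; recentred at `z₀`,
  -- this root would have a larger derivative there than `g`.
  obtain ⟨k, hkc, hk⟩ := Complex.exists_continuousOn_pow_eq hU.isSimplyConnected hUo
    hhd.continuousOn hh0 two_ne_zero
  have hkm : ∀ z ∈ U, ‖k z‖ < 1 := fun z hz => by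
    have h1 : ‖k z‖ ^ 2 < 1 := by
      rw [← norm_pow, hk]
      simpa using hhm hz
    nlinarith [norm_nonneg (k z)]
  have hkd := differentiableOn_of_sq_eq hUo hhd hkc hk fun z hz h => hh0 ⟨z, hz, h⟩
  have hki : InjOn k U := fun x hx y hy hxy => hhi hx hy (by rw [← hk, ← hk, hxy])
  have hkm' : MapsTo k U (Metric.ball 0 1) := fun z hz => by simpa using hkm z hz
  have hk0 := hkm z₀ hz₀
  have hkda := hkd.differentiableAt (hUo.mem_nhds hz₀)
  have hgda := hgd.differentiableAt (hUo.mem_nhds hz₀)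
  have hle := hmax (moebius (k z₀) ∘ k) ((differentiableOn_moebius hk0).comp hkd hkm')
    ((mapsTo_moebius hk0).comp hkm') ((bijOn_moebius hk0).injOn.comp hki hkm')
  have e1 := discDensity_moebius_mul_norm_deriv hk0 hkda hk0
  have e2 := discDensity_mul_norm_deriv_lt_of_sq_eq hkda hk0 hk
    (deriv_ne_zero_of_injOn hUo hhd hhi hz₀)
  rw [Function.comp_apply, discDensity_moebius_mul_norm_deriv hc1 hgda (hlt z₀ hz₀), ← e1,
    moebius_self] at e2
  -- The maximiser has not been normalised by `g z₀ = 0`; it is enough that the density is smallest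
  -- at the origin.
  have e3 : discDensity 0 ≤ discDensity (g z₀) := by
    rw [discDensity, discDensity]
    have := one_sub_norm_sq_pos (hlt z₀ hz₀)
    gcongr
    · simp
  have e4 := discDensity_pos (z := 0) (by simp)
  have e5 := mul_le_mul_of_nonneg_left hle e4.le
  have e6 := mul_le_mul_of_nonneg_right e3 (norm_nonneg (deriv g z₀))
  linarith

/-! ### Schwarz–Pick and its equality case on simply connected domains -/

lemma isRiemannMap_riemannMap {U : Set ℂ} (hU : IsProperSimplyConnectedDomain U) :
    IsRiemannMap U (riemannMap U) := by
  have h := exists_isRiemannMap hU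
  rw [riemannMap, dif_pos h]
  exact h.choose_spec

lemma norm_riemannMap_lt_one {U : Set ℂ} (hU : IsProperSimplyConnectedDomain U) {z : ℂ}
    (hz : z ∈ U) : ‖riemannMap U z‖ < 1 := by
  simpa using (isRiemannMap_riemannMap hU).2.mapsTo hz

/-- The pseudo-hyperbolic distance of `U`. -/
noncomputable def hypPseudoDist (U : Set ℂ) (z w : ℂ) : ℝ :=
  discPseudoDist (riemannMap U z) (riemannMap U w)

lemma hypPseudoDist_nonneg (U : Set ℂ) (z w : ℂ) : 0 ≤ hypPseudoDist U z w :=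
  discPseudoDist_nonneg _ _

lemma hypPseudoDist_comm (U : Set ℂ) (z w : ℂ) : hypPseudoDist U z w = hypPseudoDist U w z :=
  discPseudoDist_comm _ _

lemma hypPseudoDist_lt_one {U : Set ℂ} (hU : IsProperSimplyConnectedDomain U) {z w : ℂ}
    (hz : z ∈ U) (hw : w ∈ U) : hypPseudoDist U z w < 1 :=
  discPseudoDist_lt_one (norm_riemannMap_lt_one hU hz) (norm_riemannMap_lt_one hU hw)

lemma hypPseudoDist_eq_zero_iff {U : Set ℂ} (hU : IsProperSimplyConnectedDomain U) {z w : ℂ}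
    (hz : z ∈ U) (hw : w ∈ U) : hypPseudoDist U z w = 0 ↔ z = w := by
  rw [hypPseudoDist, discPseudoDist_eq_zero_iff (norm_riemannMap_lt_one hU hz)
    (norm_riemannMap_lt_one hU hw)]
  exact (isRiemannMap_riemannMap hU).2.injOn.eq_iff hz hw

/-- A Riemann map can be composed with a disc automorphism to send a given point to the origin. -/
lemma isRiemannMap_moebius_comp {U : Set ℂ} {φ : ℂ → ℂ} (hφ : IsRiemannMap U φ) {c : ℂ}
    (hc : ‖c‖ < 1) : IsRiemannMap U (moebius c ∘ φ) :=
  ⟨(differentiableOn_moebius hc).comp hφ.1 hφ.2.mapsTo, (bijOn_moebius hc).comp hφ.2⟩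

lemma hypDensity_eq {U : Set ℂ} (hU : IsProperSimplyConnectedDomain U) {a : ℂ} (ha : a ∈ U) :
    hypDensity U a = 2 * ‖deriv (moebius (riemannMap U a) ∘ riemannMap U) a‖ := by
  have h := norm_riemannMap_lt_one hU ha
  rw [hypDensity, ← discDensity_moebius_mul_norm_deriv h
    ((isRiemannMap_riemannMap hU).1.differentiableAt (hU.isOpen.mem_nhds ha)) h, moebius_self]
  simp [discDensity]

/-- **Schwarz–Pick lemma**, with bounds in terms of the hyperbolic distortion. -/
theorem hypPseudoDist_map_bounds {U V : Set ℂ} (hU : IsProperSimplyConnectedDomain U)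
    (hV : IsProperSimplyConnectedDomain V) {f : ℂ → ℂ} (hf : DifferentiableOn ℂ f U)
    (hm : MapsTo f U V) {a b : ℂ} (ha : a ∈ U) (hb : b ∈ U) :
    hypDistortion U V f a ≤ 1 ∧
    hypPseudoDist V (f a) (f b) ≤ hypPseudoDist U a b *
      (1 - (1 - hypPseudoDist U a b) * (1 - hypDistortion U V f a) / 2) ∧
    hypPseudoDist U a b * (1 - 2 * (1 - hypDistortion U V f a) / (1 - hypPseudoDist U a b)) ≤
      hypPseudoDist V (f a) (f b) := by
  have hΦ := isRiemannMap_moebius_comp (isRiemannMap_riemannMap hU) (norm_riemannMap_lt_one hU ha)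
  have hΨ := isRiemannMap_moebius_comp (isRiemannMap_riemannMap hV)
    (norm_riemannMap_lt_one hV (hm ha))
  have hρU := hypDensity_eq hU ha
  have hρV := hypDensity_eq hV (hm ha)
  have hpU : hypPseudoDist U a b = ‖(moebius (riemannMap U a) ∘ riemannMap U) b‖ := by
    rw [hypPseudoDist_comm]; rfl
  have hpV : hypPseudoDist V (f a) (f b) =
      ‖(moebius (riemannMap V (f a)) ∘ riemannMap V) (f b)‖ := by
    rw [hypPseudoDist_comm]; rfl
  have hΦa : (moebius (riemannMap U a) ∘ riemannMap U) a = 0 := moebius_self _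
  have hΨa : (moebius (riemannMap V (f a)) ∘ riemannMap V) (f a) = 0 := moebius_self _
  -- From here only centred Riemann maps `Φ`, `Ψ` matter: `h = Ψ ∘ f ∘ Φ⁻¹` fixes `0`, and the chain
  -- rule identifies `‖h'(0)‖` with the distortion.
  generalize moebius (riemannMap U a) ∘ riemannMap U = Φ at *
  generalize moebius (riemannMap V (f a)) ∘ riemannMap V = Ψ at *
  set g := Function.invFunOn Φ U with hg
  have hgd : DifferentiableOn ℂ g (Metric.ball 0 1) := by
    rw [← hΦ.2.image_eq]
    exact differentiableOn_invFunOn hU.isOpen hΦ.1 hΦ.2.injOn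
  have hgm : MapsTo g (Metric.ball 0 1) U := hΦ.2.surjOn.mapsTo_invFunOn
  have hgΦ : ∀ z ∈ U, g (Φ z) = z := fun z hz => hΦ.2.injOn.leftInvOn_invFunOn hz
  set h : ℂ → ℂ := fun w => Ψ (f (g w)) with hh
  have hhd : DifferentiableOn ℂ h (Metric.ball 0 1) :=
    hΨ.1.comp (hf.comp hgd hgm) (hm.comp hgm)
  have hhm : MapsTo h (Metric.ball 0 1) (Metric.ball 0 1) :=
    hΨ.2.mapsTo.comp (hm.comp hgm)
  have hhΦ : ∀ z ∈ U, h (Φ z) = Ψ (f z) := fun z hz => by rw [hh]; simp only [hgΦ z hz]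
  have hh0 : h 0 = 0 := by rw [← hΦa, hhΦ a ha, hΨa, hΦa]
  have hΦd := (hΦ.1.differentiableAt (hU.isOpen.mem_nhds ha)).hasDerivAt
  have hΨd := (hΨ.1.differentiableAt (hV.isOpen.mem_nhds (hm ha))).hasDerivAt
  have hfd := (hf.differentiableAt (hU.isOpen.mem_nhds ha)).hasDerivAt
  have hhd0 : HasDerivAt h (deriv h 0) (Φ a) := by
    rw [hΦa]
    exact (hhd.differentiableAt (Metric.ball_mem_nhds 0 one_pos)).hasDerivAt
  have hchain : deriv h 0 * deriv Φ a = deriv Ψ (f a) * deriv f a := by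
    refine (hhd0.comp a hΦd).unique ((hΨd.comp a hfd).congr_of_eventuallyEq ?_)
    filter_upwards [hU.isOpen.mem_nhds ha] with z hz
    exact hhΦ z hz
  have hΦ0 : ‖deriv Φ a‖ ≠ 0 :=
    norm_ne_zero_iff.mpr (deriv_ne_zero_of_injOn hU.isOpen hΦ.1 hΦ.2.injOn ha)
  have hdist : hypDistortion U V f a = ‖deriv h 0‖ := by
    rw [hypDistortion, hρU, hρV, mul_assoc, ← norm_mul, ← hchain, norm_mul]
    field_simp
  have hΦb : ‖Φ b‖ < 1 := by simpa using hΦ.2.mapsTo hb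
  have := norm_bounds_of_mapsTo_ball hhd hhm hh0 hΦb
  rwa [hhΦ b hb, ← hpU, ← hpV, ← hdist] at this

lemma hypPseudoDist_map_le {U V : Set ℂ} (hU : IsProperSimplyConnectedDomain U)
    (hV : IsProperSimplyConnectedDomain V) {f : ℂ → ℂ} (hf : DifferentiableOn ℂ f U)
    (hm : MapsTo f U V) {a b : ℂ} (ha : a ∈ U) (hb : b ∈ U) :
    hypPseudoDist V (f a) (f b) ≤ hypPseudoDist U a b := by
  obtain ⟨h1, h2, -⟩ := hypPseudoDist_map_bounds hU hV hf hm ha hb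
  refine h2.trans (mul_le_of_le_one_right (hypPseudoDist_nonneg _ _ _) ?_)
  have := mul_nonneg (sub_nonneg.mpr (hypPseudoDist_lt_one hU ha hb).le) (sub_nonneg.mpr h1)
  linarith

lemma hypPseudoDist_map_eq_of_hypDistortion_eq_one {U V : Set ℂ}
    (hU : IsProperSimplyConnectedDomain U)
    (hV : IsProperSimplyConnectedDomain V) {f : ℂ → ℂ} (hf : DifferentiableOn ℂ f U)
    (hm : MapsTo f U V) {a b : ℂ} (ha : a ∈ U) (hb : b ∈ U) (h : hypDistortion U V f a = 1) :
    hypPseudoDist V (f a) (f b) = hypPseudoDist U a b := by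
  obtain ⟨-, h2, h3⟩ := hypPseudoDist_map_bounds hU hV hf hm ha hb
  simp only [h, sub_self, mul_zero, zero_div, sub_zero, mul_one] at h2 h3
  exact le_antisymm h2 h3

/-- Were the distortion less than `1`, the upper bound of `hypPseudoDist_map_bounds` would strictly
shrink the positive distance from `a` to `b`. -/
lemma hypDistortion_eq_one_of_hypPseudoDist_map_eq {U V : Set ℂ}
    (hU : IsProperSimplyConnectedDomain U)
    (hV : IsProperSimplyConnectedDomain V) {f : ℂ → ℂ} (hf : DifferentiableOn ℂ f U)
    (hm : MapsTo f U V) {a b : ℂ} (ha : a ∈ U) (hb : b ∈ U) (hab : a ≠ b)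
    (h : hypPseudoDist V (f a) (f b) = hypPseudoDist U a b) : hypDistortion U V f a = 1 := by
  obtain ⟨h1, h2, -⟩ := hypPseudoDist_map_bounds hU hV hf hm ha hb
  refine le_antisymm h1 ?_
  have hp : 0 < hypPseudoDist U a b := (hypPseudoDist_nonneg _ _ _).lt_of_ne
    fun h0 => hab ((hypPseudoDist_eq_zero_iff hU ha hb).mp h0.symm)
  have hp1 := sub_pos.mpr (hypPseudoDist_lt_one hU ha hb)
  rw [h] at h2
  have h3 : 1 ≤ 1 - (1 - hypPseudoDist U a b) * (1 - hypDistortion U V f a) / 2 :=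
    le_of_mul_le_mul_left (by rwa [mul_one]) hp
  by_contra! hlt
  have := mul_pos hp1 (sub_pos.mpr hlt)
  linarith

/-- A holomorphic map with hyperbolic distortion one at one point has distortion one everywhere. -/
lemma hypDistortion_eq_one_of_hypDistortion_eq_one {U V : Set ℂ}
    (hU : IsProperSimplyConnectedDomain U)
    (hV : IsProperSimplyConnectedDomain V) {f : ℂ → ℂ} (hf : DifferentiableOn ℂ f U)
    (hm : MapsTo f U V) {a c : ℂ} (ha : a ∈ U) (hc : c ∈ U) (h : hypDistortion U V f a = 1) :
    hypDistortion U V f c = 1 := by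
  rcases eq_or_ne c a with rfl | hne
  · exact h
  · refine hypDistortion_eq_one_of_hypPseudoDist_map_eq hU hV hf hm hc ha hne ?_
    rw [hypPseudoDist_comm, hypPseudoDist_comm U]
    exact hypPseudoDist_map_eq_of_hypDistortion_eq_one hU hV hf hm ha hc h

/-! ### Sequences contracted by factors close to one -/

section RealSequences

lemma tendsto_zero_of_le_mul {r ε : ℕ → ℝ} {s : ℝ} (hs : s < 1) (hr : ∀ n, 0 ≤ r n)
    (hrs : ∀ n, r n ≤ s) (hε : ∀ n, 0 ≤ ε n)
    (hstep : ∀ n, r (n + 1) ≤ r n * (1 - (1 - r n) * ε n / 2))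
    (hdiv : Tendsto (fun n => ∑ i ∈ Finset.range n, ε i) atTop atTop) :
    Tendsto r atTop (𝓝 0) := by
  have hle : ∀ n, r n ≤ r 0 * Real.exp (-((1 - s) / 2 * ∑ i ∈ Finset.range n, ε i)) := by
    intro n
    induction n with
    | zero => simp
    | succ n ih =>
      -- Uses `1 - r n ≥ 1 - s` and `1 - x ≤ exp (-x)`, turning the product of factors into a sum.
      have h1 : 1 - (1 - r n) * ε n / 2 ≤ Real.exp (-((1 - s) / 2 * ε n)) := by
        have := Real.add_one_le_exp (-((1 - s) / 2 * ε n))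
        nlinarith [mul_nonneg (sub_nonneg.mpr (hrs n)) (hε n)]
      calc r (n + 1) ≤ r n * (1 - (1 - r n) * ε n / 2) := hstep n
        _ ≤ r n * Real.exp (-((1 - s) / 2 * ε n)) := mul_le_mul_of_nonneg_left h1 (hr n)
        _ ≤ _ := mul_le_mul_of_nonneg_right ih (Real.exp_pos _).le
        _ = _ := by
          rw [Finset.sum_range_succ, mul_assoc, ← Real.exp_add]
          congr 2
          ring
  refine squeeze_zero hr hle ?_
  have : Tendsto (fun n => Real.exp (-((1 - s) / 2 * ∑ i ∈ Finset.range n, ε i))) atTop (𝓝 0) :=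
    Real.tendsto_exp_neg_atTop_nhds_zero.comp (hdiv.const_mul_atTop (by linarith))
  simpa using this.const_mul (r 0)

lemma exists_pos_le_of_mul_le {r ε : ℕ → ℝ} {s : ℝ} (hs : s < 1) (hr : ∀ n, 0 < r n)
    (hanti : Antitone r) (hrs : ∀ n, r n ≤ s) (hε : ∀ n, 0 ≤ ε n)
    (hstep : ∀ n, r n * (1 - 2 * ε n / (1 - r n)) ≤ r (n + 1))
    (hdiv : ¬ Tendsto (fun n => ∑ i ∈ Finset.range n, ε i) atTop atTop) :
    ∃ δ, 0 < δ ∧ ∀ᶠ n in atTop, δ ≤ r n := by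
  have hmono : Monotone fun n => ∑ i ∈ Finset.range n, ε i := fun m n h =>
    Finset.sum_le_sum_of_subset_of_nonneg (Finset.range_mono h) fun i _ _ => hε i
  obtain ⟨L, hL⟩ := (tendsto_atTop_of_monotone hmono).resolve_left hdiv
  have hSL : ∀ n, ∑ i ∈ Finset.range n, ε i ≤ L := hmono.ge_of_tendsto hL
  -- The tail beyond `N` is below `(1 - s)/4`; as each step loses at most `r N * (2/(1 - s)) * ε n`,
  -- the total loss is at most `r N / 2`.
  obtain ⟨N, hN⟩ := (hL.eventually (lt_mem_nhds (show L - (1 - s) / 4 < L by linarith))).exists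
  have hs' : 0 < 1 - s := by linarith
  refine ⟨r N / 2, half_pos (hr N), eventually_atTop.mpr ⟨N, fun n hn => ?_⟩⟩
  have key : r N * (1 - 2 / (1 - s) *
      (∑ i ∈ Finset.range n, ε i - ∑ i ∈ Finset.range N, ε i)) ≤ r n := by
    induction n, hn using Nat.le_induction with
    | base => simp
    | succ n hn ih =>
      have h1 : r n * (2 * ε n / (1 - r n)) ≤ r N * (2 / (1 - s) * ε n) := by
        have h2 : 2 * ε n / (1 - r n) ≤ 2 / (1 - s) * ε n := by
          rw [div_mul_eq_mul_div]
          exact div_le_div_of_nonneg_left (mul_nonneg zero_le_two (hε n)) hs'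
            (by linarith [hrs n])
        exact mul_le_mul (hanti hn) h2 (div_nonneg (mul_nonneg zero_le_two (hε n))
          (by linarith [hrs n])) (hr N).le
      rw [Finset.sum_range_succ]
      nlinarith [hstep n]
  refine le_trans ?_ key
  have h3 : 2 / (1 - s) * (∑ i ∈ Finset.range n, ε i - ∑ i ∈ Finset.range N, ε i) ≤
      2 / (1 - s) * ((1 - s) / 4) := by
    gcongr
    linarith [hSL n]
  have h4 : 2 / (1 - s) * ((1 - s) / 4) = 1 / 2 := by field_simp; norm_num
  nlinarith [hr N]

end RealSequences

/-! ### Forward systems: orbits, merging and the trichotomy -/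

/-- The hyperbolic distance as a function of the pseudo-hyperbolic distance. -/
noncomputable def pseudoToHyp (r : ℝ) : ℝ := Real.log ((1 + r) / (1 - r))

@[simp] lemma pseudoToHyp_zero : pseudoToHyp 0 = 0 := by simp [pseudoToHyp]

lemma strictMonoOn_pseudoToHyp : StrictMonoOn pseudoToHyp (Ico 0 1) := by
  intro a ha b hb hab
  have ha' : 0 < 1 - a := by linarith [ha.2]
  have hb' : 0 < 1 - b := by linarith [hb.2]
  refine Real.log_lt_log (div_pos (by linarith [ha.1]) ha') ?_
  rw [div_lt_div_iff₀ ha' hb']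
  nlinarith

lemma continuousAt_pseudoToHyp {r : ℝ} (h0 : 0 ≤ r) (h1 : r < 1) :
    ContinuousAt pseudoToHyp r := by
  have h : 1 - r ≠ 0 := by linarith
  have h' : (1 + r) / (1 - r) ≠ 0 := div_ne_zero (by linarith) h
  unfold pseudoToHyp
  fun_prop (disch := assumption)

/-- The standing assumptions on a sequence of non-constant holomorphic maps between proper simply
connected domains. -/
structure IsForwardSystem (U : ℕ → Set ℂ) (f : ℕ → ℂ → ℂ) : Prop where
  domain : ∀ n, IsProperSimplyConnectedDomain (U n)
  differentiableOn : ∀ n, DifferentiableOn ℂ (f (n + 1)) (U n)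
  mapsTo : ∀ n, MapsTo (f (n + 1)) (U n) (U (n + 1))
  nonconst : ∀ n, ∃ z ∈ U n, ∃ w ∈ U n, f (n + 1) z ≠ f (n + 1) w

/-- Pseudo-hyperbolic distance in `U n` between the `n`-th points of two orbits. -/
noncomputable def orbitPseudoDist (U : ℕ → Set ℂ) (f : ℕ → ℂ → ℂ) (n : ℕ) (z z' : ℂ) : ℝ :=
  hypPseudoDist (U n) (forwardComp f n z) (forwardComp f n z')

lemma orbitDist_eq_pseudoToHyp (U : ℕ → Set ℂ) (f : ℕ → ℂ → ℂ) (n : ℕ) (z z' : ℂ) :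
    orbitDist U f n z z' = pseudoToHyp (orbitPseudoDist U f n z z') := rfl

lemma orbitPseudoDist_comm (U : ℕ → Set ℂ) (f : ℕ → ℂ → ℂ) (n : ℕ) (z z' : ℂ) :
    orbitPseudoDist U f n z z' = orbitPseudoDist U f n z' z := hypPseudoDist_comm _ _ _

lemma forwardComp_eq_of_le {f : ℕ → ℂ → ℂ} {z z' : ℂ} {m n : ℕ} (hmn : m ≤ n)
    (h : forwardComp f m z = forwardComp f m z') : forwardComp f n z = forwardComp f n z' := by
  induction n, hmn using Nat.le_induction with
  | base => exact h
  | succ n _ ih => simp [forwardComp, ih]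

namespace IsForwardSystem

variable {U : ℕ → Set ℂ} {f : ℕ → ℂ → ℂ}

lemma isPreconnected (h : IsForwardSystem U f) (n : ℕ) : IsPreconnected (U n) :=
  (h.domain n).isSimplyConnected.isPathConnected.isConnected.isPreconnected

lemma mapsTo_forwardComp (h : IsForwardSystem U f) (n : ℕ) :
    MapsTo (forwardComp f n) (U 0) (U n) := by
  induction n with
  | zero => exact mapsTo_id _
  | succ n ih => exact (h.mapsTo n).comp ih

lemma differentiableOn_forwardComp (h : IsForwardSystem U f) (n : ℕ) :
    DifferentiableOn ℂ (forwardComp f n) (U 0) := by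
  induction n with
  | zero => exact differentiableOn_id
  | succ n ih => exact (h.differentiableOn n).comp ih (h.mapsTo_forwardComp n)

/-- By the open mapping theorem at each step. Openness of the image is what shows that a composition
of non-constant maps is non-constant. -/
lemma isOpen_image_forwardComp (h : IsForwardSystem U f) (n : ℕ) :
    IsOpen (forwardComp f n '' U 0) := by
  induction n with
  | zero => simpa [forwardComp] using (h.domain 0).isOpen
  | succ n ih =>
    rw [forwardComp, image_comp]
    refine ((analyticOnNhd_of_differentiableOn (h.domain n).isOpen
      (h.differentiableOn n)).is_constant_or_isOpen (h.isPreconnected n)).resolve_left ?_ _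
      (mapsTo_iff_image_subset.mp (h.mapsTo_forwardComp n)) ih
    rintro ⟨c, hc⟩
    obtain ⟨z, hz, w, hw, hne⟩ := h.nonconst n
    exact hne (by rw [hc z hz, hc w hw])

/-- A constant composition would have a singleton as its open image, so fibres are discrete by the
identity theorem, and a discrete Lindelöf set is countable. -/
lemma countable_forwardComp_eq (h : IsForwardSystem U f) (n : ℕ) (c : ℂ) :
    {w | forwardComp f n w = c} ∩ U 0 |>.Countable := by
  have hev := ((analyticOnNhd_of_differentiableOn (h.domain 0).isOpen
    (h.differentiableOn_forwardComp n)).eqOn_or_eventually_ne_of_preconnected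
    (analyticOnNhd_const (v := c)) (h.isPreconnected 0)).resolve_left fun heq => by
      have himg : forwardComp f n '' U 0 = {c} :=
        (heq.image_eq).trans ((h.domain 0).isSimplyConnected.nonempty.image_const c)
      exact not_isOpen_singleton c (himg ▸ h.isOpen_image_forwardComp n)
  refine (HereditarilyLindelofSpace.isLindelof _).countable_of_isDiscrete
    (isDiscrete_of_codiscreteWithin ?_)
  simpa [compl_ofPred] using! hev

/-- Every orbit has an orbit that it never meets. -/
lemma exists_notMem_mergeSet (h : IsForwardSystem U f) (z : ℂ) :
    ∃ z' ∈ U 0, (z, z') ∉ mergeSet U f := by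
  have hc : (⋃ n, {w | forwardComp f n w = forwardComp f n z} ∩ U 0).Countable :=
    countable_iUnion fun n => h.countable_forwardComp_eq n _
  obtain ⟨w, hw, hwc⟩ := (hc.dense_compl ℝ).inter_open_nonempty (U 0) (h.domain 0).isOpen
    (h.domain 0).isSimplyConnected.nonempty
  refine ⟨w, hw, fun ⟨_, n, _, hn⟩ => hwc (mem_iUnion.mpr ⟨n, hn.symm, hw⟩)⟩

lemma forwardComp_ne (_ : IsForwardSystem U f) {z z' : ℂ} (hz : z ∈ U 0) (hz' : z' ∈ U 0)
    (hE : (z, z') ∉ mergeSet U f) (n : ℕ) : forwardComp f n z ≠ forwardComp f n z' := fun heq =>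
  -- Passing to `n + 1` covers `n = 0`, since `mergeSet` only looks at positive times.
  hE ⟨⟨hz, hz'⟩, n + 1, by omega, forwardComp_eq_of_le n.le_succ heq⟩

lemma orbitPseudoDist_mem_Ico (h : IsForwardSystem U f) {z z' : ℂ} (hz : z ∈ U 0)
    (hz' : z' ∈ U 0) (n : ℕ) : orbitPseudoDist U f n z z' ∈ Ico (0 : ℝ) 1 :=
  ⟨hypPseudoDist_nonneg _ _ _, hypPseudoDist_lt_one (h.domain n) (h.mapsTo_forwardComp n hz)
    (h.mapsTo_forwardComp n hz')⟩

lemma orbitPseudoDist_pos (h : IsForwardSystem U f) {z z' : ℂ} (hz : z ∈ U 0)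
    (hz' : z' ∈ U 0) (hE : (z, z') ∉ mergeSet U f) (n : ℕ) : 0 < orbitPseudoDist U f n z z' :=
  (hypPseudoDist_nonneg _ _ _).lt_of_ne fun h0 => h.forwardComp_ne hz hz' hE n
    ((hypPseudoDist_eq_zero_iff (h.domain n) (h.mapsTo_forwardComp n hz)
      (h.mapsTo_forwardComp n hz')).mp h0.symm)

lemma antitone_orbitPseudoDist (h : IsForwardSystem U f) {z z' : ℂ} (hz : z ∈ U 0)
    (hz' : z' ∈ U 0) : Antitone fun n => orbitPseudoDist U f n z z' :=
  antitone_nat_of_succ_le fun n => hypPseudoDist_map_le (h.domain n) (h.domain (n + 1))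
    (h.differentiableOn n) (h.mapsTo n) (h.mapsTo_forwardComp n hz) (h.mapsTo_forwardComp n hz')

lemma orbitPseudoDist_bounds (h : IsForwardSystem U f) {z z' : ℂ} (hz : z ∈ U 0)
    (hz' : z' ∈ U 0) (n : ℕ) :
    orbitDistortion U f (n + 1) z ≤ 1 ∧
    orbitPseudoDist U f (n + 1) z z' ≤ orbitPseudoDist U f n z z' *
      (1 - (1 - orbitPseudoDist U f n z z') * (1 - orbitDistortion U f (n + 1) z) / 2) ∧
    orbitPseudoDist U f n z z' *
      (1 - 2 * (1 - orbitDistortion U f (n + 1) z) / (1 - orbitPseudoDist U f n z z')) ≤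
      orbitPseudoDist U f (n + 1) z z' :=
  hypPseudoDist_map_bounds (h.domain n) (h.domain (n + 1)) (h.differentiableOn n) (h.mapsTo n)
    (h.mapsTo_forwardComp n hz) (h.mapsTo_forwardComp n hz')

lemma exists_tendsto_orbitPseudoDist (h : IsForwardSystem U f) {z z' : ℂ} (hz : z ∈ U 0)
    (hz' : z' ∈ U 0) :
    ∃ l ∈ Ico (0 : ℝ) 1, Tendsto (fun n => orbitPseudoDist U f n z z') atTop (𝓝 l) ∧
      ∀ n, l ≤ orbitPseudoDist U f n z z' := by
  have hlim := tendsto_atTop_ciInf (h.antitone_orbitPseudoDist hz hz')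
    ⟨0, by rintro _ ⟨n, rfl⟩; exact (h.orbitPseudoDist_mem_Ico hz hz' n).1⟩
  have hle := (h.antitone_orbitPseudoDist hz hz').le_of_tendsto hlim
  exact ⟨_, ⟨ge_of_tendsto' hlim fun n => (h.orbitPseudoDist_mem_Ico hz hz' n).1,
    (hle 0).trans_lt (h.orbitPseudoDist_mem_Ico hz hz' 0).2⟩, hlim, hle⟩

lemma tendsto_orbitDist (_ : IsForwardSystem U f) {z z' : ℂ} {l : ℝ} (hl : l ∈ Ico (0 : ℝ) 1)
    (hlim : Tendsto (fun n => orbitPseudoDist U f n z z') atTop (𝓝 l)) :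
    Tendsto (fun n => orbitDist U f n z z') atTop (𝓝 (pseudoToHyp l)) :=
  (continuousAt_pseudoToHyp hl.1 hl.2).tendsto.comp hlim

lemma tendsto_orbitPseudoDist_zero (h : IsForwardSystem U f) {z z' : ℂ} (hz : z ∈ U 0)
    (hz' : z' ∈ U 0)
    (hdiv : Tendsto (fun N => ∑ n ∈ Finset.range N, (1 - orbitDistortion U f (n + 1) z))
      atTop atTop) :
    Tendsto (fun n => orbitPseudoDist U f n z z') atTop (𝓝 0) :=
  tendsto_zero_of_le_mul (h.orbitPseudoDist_mem_Ico hz hz' 0).2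
    (fun n => (h.orbitPseudoDist_mem_Ico hz hz' n).1)
    (fun n => h.antitone_orbitPseudoDist hz hz' n.zero_le)
    (fun n => sub_nonneg.mpr (h.orbitPseudoDist_bounds hz hz' n).1)
    (fun n => (h.orbitPseudoDist_bounds hz hz' n).2.1) hdiv

lemma not_tendsto_orbitPseudoDist_zero (h : IsForwardSystem U f) {z z' : ℂ} (hz : z ∈ U 0)
    (hz' : z' ∈ U 0) (hE : (z, z') ∉ mergeSet U f)
    (hdiv : ¬ Tendsto (fun N => ∑ n ∈ Finset.range N, (1 - orbitDistortion U f (n + 1) z))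
      atTop atTop) :
    ¬ Tendsto (fun n => orbitPseudoDist U f n z z') atTop (𝓝 0) := fun hlim => by
  obtain ⟨δ, hδ, hle⟩ := exists_pos_le_of_mul_le (h.orbitPseudoDist_mem_Ico hz hz' 0).2
    (fun n => h.orbitPseudoDist_pos hz hz' hE n) (h.antitone_orbitPseudoDist hz hz')
    (fun n => h.antitone_orbitPseudoDist hz hz' n.zero_le)
    (fun n => sub_nonneg.mpr (h.orbitPseudoDist_bounds hz hz' n).1)
    (fun n => (h.orbitPseudoDist_bounds hz hz' n).2.2) hdiv
  exact hδ.not_ge (ge_of_tendsto hlim hle)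

lemma tendsto_orbitPseudoDist_of_tendsto_orbitDist (h : IsForwardSystem U f) {z z' : ℂ}
    (hz : z ∈ U 0) (hz' : z' ∈ U 0)
    (hlim : Tendsto (fun n => orbitDist U f n z z') atTop (𝓝 0)) :
    Tendsto (fun n => orbitPseudoDist U f n z z') atTop (𝓝 0) := by
  obtain ⟨l, hl, hlim', -⟩ := h.exists_tendsto_orbitPseudoDist hz hz'
  have h0 : pseudoToHyp l = pseudoToHyp 0 := by
    rw [pseudoToHyp_zero]
    exact tendsto_nhds_unique (h.tendsto_orbitDist hl hlim') hlim
  rwa [strictMonoOn_pseudoToHyp.injOn hl (by simp) h0] at hlim'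

lemma swap_notMem_mergeSet (_ : IsForwardSystem U f) {z z' : ℂ}
    (hE : (z, z') ∉ mergeSet U f) : (z', z) ∉ mergeSet U f := fun ⟨hm, n, hn, heq⟩ =>
  hE ⟨⟨hm.2, hm.1⟩, n, hn, heq.symm⟩

lemma isContracting_of_tendsto (h : IsForwardSystem U f) {z : ℂ} (hz : z ∈ U 0)
    (hdiv : Tendsto (fun N => ∑ n ∈ Finset.range N, (1 - orbitDistortion U f (n + 1) z))
      atTop atTop) : IsContracting U f := by
  intro w hw w' hw'
  suffices hp : Tendsto (fun n => orbitPseudoDist U f n w w') atTop (𝓝 0) by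
    simpa using h.tendsto_orbitDist (by simp) hp
  -- Divergence is assumed at `z` only. If `w` merges with `z`, its orbit may be replaced by that of
  -- `z`. Otherwise the distance from `w` to `z` tends to `0`, so the series at `w` diverges too.
  by_cases hE : (z, w) ∈ mergeSet U f
  · obtain ⟨-, m, -, hm⟩ := hE
    refine (h.tendsto_orbitPseudoDist_zero hz hw' hdiv).congr' ?_
    filter_upwards [eventually_ge_atTop m] with n hn
    rw [orbitPseudoDist, orbitPseudoDist, forwardComp_eq_of_le hn hm]
  · refine h.tendsto_orbitPseudoDist_zero hw hw' ?_
    by_contra hdiv'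
    refine h.not_tendsto_orbitPseudoDist_zero hw hz (h.swap_notMem_mergeSet hE) hdiv' ?_
    simpa only [orbitPseudoDist_comm] using h.tendsto_orbitPseudoDist_zero hz hw hdiv

lemma isContracting_iff (h : IsForwardSystem U f) {z : ℂ} (hz : z ∈ U 0) :
    IsContracting U f ↔
      Tendsto (fun N => ∑ n ∈ Finset.range N, (1 - orbitDistortion U f (n + 1) z))
        atTop atTop := by
  refine ⟨fun hc => ?_, h.isContracting_of_tendsto hz⟩
  obtain ⟨z', hz', hE⟩ := h.exists_notMem_mergeSet z
  by_contra hdiv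
  exact h.not_tendsto_orbitPseudoDist_zero hz hz' hE hdiv
    (h.tendsto_orbitPseudoDist_of_tendsto_orbitDist hz hz' (hc z hz z' hz'))

/-- Distortion `1` moves from the orbit of `z` to that of `w` by rigidity, so one base point
controls every pair. -/
lemma orbitPseudoDist_succ_eq (h : IsForwardSystem U f) {z w w' : ℂ} (hz : z ∈ U 0)
    (hw : w ∈ U 0) (hw' : w' ∈ U 0) {n : ℕ} (h1 : orbitDistortion U f (n + 1) z = 1) :
    orbitPseudoDist U f (n + 1) w w' = orbitPseudoDist U f n w w' :=
  hypPseudoDist_map_eq_of_hypDistortion_eq_one (h.domain n) (h.domain (n + 1))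
    (h.differentiableOn n) (h.mapsTo n) (h.mapsTo_forwardComp n hw) (h.mapsTo_forwardComp n hw')
    (hypDistortion_eq_one_of_hypDistortion_eq_one (h.domain n) (h.domain (n + 1))
      (h.differentiableOn n) (h.mapsTo n) (h.mapsTo_forwardComp n hz) (h.mapsTo_forwardComp n hw)
      h1)

lemma orbitDistortion_succ_eq_one (h : IsForwardSystem U f) {z z' : ℂ} (hz : z ∈ U 0)
    (hz' : z' ∈ U 0) (hE : (z, z') ∉ mergeSet U f) {n : ℕ}
    (heq : orbitPseudoDist U f (n + 1) z z' = orbitPseudoDist U f n z z') :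
    orbitDistortion U f (n + 1) z = 1 :=
  hypDistortion_eq_one_of_hypPseudoDist_map_eq (h.domain n) (h.domain (n + 1))
    (h.differentiableOn n) (h.mapsTo n) (h.mapsTo_forwardComp n hz) (h.mapsTo_forwardComp n hz')
    (h.forwardComp_ne hz hz' hE n) heq

lemma isEventuallyIsometric_of_eventually_eq_one (h : IsForwardSystem U f) {z : ℂ}
    (hz : z ∈ U 0) {N : ℕ} (hN : ∀ n, N ≤ n → orbitDistortion U f (n + 1) z = 1) :
    IsEventuallyIsometric U f := by
  refine ⟨N + 1, N.succ_pos, fun w w' ⟨⟨hw, hw'⟩, hE⟩ =>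
    ⟨orbitDist U f N w w', ?_, fun n hn => ?_⟩⟩
  · rw [orbitDist_eq_pseudoToHyp, ← pseudoToHyp_zero]
    exact strictMonoOn_pseudoToHyp (by simp) (h.orbitPseudoDist_mem_Ico hw hw' N)
      (h.orbitPseudoDist_pos hw hw' hE N)
  · rw [orbitDist_eq_pseudoToHyp, orbitDist_eq_pseudoToHyp]
    congr 1
    have hn' : N ≤ n := by omega
    clear hn
    induction n, hn' using Nat.le_induction with
    | base => rfl
    | succ n hn ih => rw [h.orbitPseudoDist_succ_eq hz hw hw' (hN n hn), ih]

lemma isEventuallyIsometric_iff (h : IsForwardSystem U f) {z : ℂ} (hz : z ∈ U 0) :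
    IsEventuallyIsometric U f ↔ ∀ᶠ n in atTop, orbitDistortion U f n z = 1 := by
  refine ⟨fun ⟨N, hN, hiso⟩ => ?_, fun hev => ?_⟩
  · obtain ⟨z', hz', hE⟩ := h.exists_notMem_mergeSet z
    obtain ⟨c, -, hc⟩ := hiso z z' ⟨⟨hz, hz'⟩, hE⟩
    refine eventually_atTop.mpr ⟨N + 1, fun n hn => ?_⟩
    obtain ⟨m, rfl⟩ := Nat.exists_eq_add_of_le' (show 1 ≤ n by omega)
    refine h.orbitDistortion_succ_eq_one hz hz' hE
      (strictMonoOn_pseudoToHyp.injOn (h.orbitPseudoDist_mem_Ico hz hz' _)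
        (h.orbitPseudoDist_mem_Ico hz hz' _) ?_)
    rw [← orbitDist_eq_pseudoToHyp, ← orbitDist_eq_pseudoToHyp, hc m (by omega),
      hc (m + 1) (by omega)]
  · obtain ⟨N, hN⟩ := eventually_atTop.mp hev
    exact h.isEventuallyIsometric_of_eventually_eq_one hz (N := N) fun n hn =>
      hN (n + 1) (hn.trans n.le_succ)

/-- The limit is positive because the series converges. If it were attained at time `n`,
monotonicity would freeze the distance from `n` on, and all later distortions would be `1`. -/
lemma isSemiContracting_of_not (h : IsForwardSystem U f) (hc : ¬ IsContracting U f)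
    (hi : ¬ IsEventuallyIsometric U f) : IsSemiContracting U f := by
  intro z z' ⟨⟨hz, hz'⟩, hE⟩
  obtain ⟨l, hl, hlim, hle⟩ := h.exists_tendsto_orbitPseudoDist hz hz'
  have hl0 : 0 < l := hl.1.lt_of_ne fun h0 =>
    h.not_tendsto_orbitPseudoDist_zero hz hz' hE (fun hd => hc ((h.isContracting_iff hz).mpr hd))
      (h0 ▸ hlim)
  refine ⟨pseudoToHyp l, ?_, h.tendsto_orbitDist hl hlim, fun n _ heq => hi ?_⟩
  · rw [← pseudoToHyp_zero]
    exact strictMonoOn_pseudoToHyp (by simp) hl hl0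
  · have hn : orbitPseudoDist U f n z z' = l :=
      strictMonoOn_pseudoToHyp.injOn (h.orbitPseudoDist_mem_Ico hz hz' n) hl heq
    have hconst : ∀ m, n ≤ m → orbitPseudoDist U f m z z' = l := fun m hm =>
      le_antisymm (hn ▸ h.antitone_orbitPseudoDist hz hz' hm) (hle m)
    refine h.isEventuallyIsometric_of_eventually_eq_one hz (N := n) fun m hm =>
      h.orbitDistortion_succ_eq_one hz hz' hE ?_
    rw [hconst m hm, hconst (m + 1) (by omega)]

lemma not_isContracting_of_isSemiContracting (h : IsForwardSystem U f)
    (hs : IsSemiContracting U f) : ¬ IsContracting U f := fun hc => by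
  obtain ⟨z, hz⟩ := (h.domain 0).isSimplyConnected.nonempty
  obtain ⟨z', hz', hE⟩ := h.exists_notMem_mergeSet z
  obtain ⟨c, hpos, hlim, -⟩ := hs z z' ⟨⟨hz, hz'⟩, hE⟩
  exact hpos.ne (tendsto_nhds_unique (hc z hz z' hz') hlim)

lemma not_isContracting_of_isEventuallyIsometric (h : IsForwardSystem U f)
    (hi : IsEventuallyIsometric U f) : ¬ IsContracting U f := fun hc => by
  obtain ⟨z, hz⟩ := (h.domain 0).isSimplyConnected.nonempty
  obtain ⟨z', hz', hE⟩ := h.exists_notMem_mergeSet z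
  obtain ⟨N, -, hN⟩ := hi
  obtain ⟨c, hpos, hconst⟩ := hN z z' ⟨⟨hz, hz'⟩, hE⟩
  exact hpos.ne (tendsto_nhds_unique (hc z hz z' hz')
    (tendsto_const_nhds.congr' (eventually_atTop.mpr ⟨N, fun n hn => (hconst n hn).symm⟩)))

lemma not_isEventuallyIsometric_of_isSemiContracting (h : IsForwardSystem U f)
    (hs : IsSemiContracting U f) : ¬ IsEventuallyIsometric U f := fun ⟨N, hN0, hN⟩ => by
  obtain ⟨z, hz⟩ := (h.domain 0).isSimplyConnected.nonempty
  obtain ⟨z', hz', hE⟩ := h.exists_notMem_mergeSet z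
  obtain ⟨c, -, hconst⟩ := hN z z' ⟨⟨hz, hz'⟩, hE⟩
  obtain ⟨c', -, hlim, hne⟩ := hs z z' ⟨⟨hz, hz'⟩, hE⟩
  have : c = c' := tendsto_nhds_unique
    (tendsto_const_nhds.congr' (eventually_atTop.mpr ⟨N, fun n hn => (hconst n hn).symm⟩)) hlim
  -- Positivity of `N` matters: semi-contraction excludes the limit value only at times `n ≥ 1`.
  exact hne N hN0 (this ▸ hconst N le_rfl)

end IsForwardSystem

/-! ### Reindexing and the final statement -/

lemma sum_Icc_one_eq_sum_range (a : ℕ → ℝ) (N : ℕ) :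
    ∑ n ∈ Finset.Icc 1 N, a n = ∑ n ∈ Finset.range N, a (n + 1) := by
  induction N with
  | zero => simp
  | succ N ih => rw [Finset.sum_Icc_succ_top (by omega), ih, Finset.sum_range_succ]

end HyperbolicClassification

theorem mainTheorem9 (U : ℕ → Set ℂ) (f : ℕ → ℂ → ℂ)
    (hU : ∀ n, HyperbolicClassification.IsProperSimplyConnectedDomain (U n))
    (hf : ∀ n, 1 ≤ n → DifferentiableOn ℂ (f n) (U (n - 1)))
    (hmaps : ∀ n, 1 ≤ n → MapsTo (f n) (U (n - 1)) (U n))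
    (hnonconst : ∀ n, 1 ≤ n → ∃ z ∈ U (n - 1), ∃ w ∈ U (n - 1), f n z ≠ f n w) :
    -- exactly one of the three cases holds
    ((HyperbolicClassification.IsContracting U f ∧
        ¬ HyperbolicClassification.IsSemiContracting U f ∧
        ¬ HyperbolicClassification.IsEventuallyIsometric U f) ∨
      (¬ HyperbolicClassification.IsContracting U f ∧
        HyperbolicClassification.IsSemiContracting U f ∧
        ¬ HyperbolicClassification.IsEventuallyIsometric U f) ∨
      (¬ HyperbolicClassification.IsContracting U f ∧
        ¬ HyperbolicClassification.IsSemiContracting U f ∧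
        HyperbolicClassification.IsEventuallyIsometric U f)) ∧
    -- the criteria, valid at every base point
    (∀ z ∈ U 0, (HyperbolicClassification.IsContracting U f ↔
      Tendsto (fun N : ℕ => ∑ n ∈ Finset.Icc 1 N,
        (1 - HyperbolicClassification.orbitDistortion U f n z)) atTop atTop)) ∧
    (∀ z ∈ U 0, (HyperbolicClassification.IsEventuallyIsometric U f ↔
      ∀ᶠ n in atTop, HyperbolicClassification.orbitDistortion U f n z = 1)) := by
  have h : HyperbolicClassification.IsForwardSystem U f :=
    ⟨hU, fun n => hf (n + 1) n.succ_pos, fun n => hmaps (n + 1) n.succ_pos,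
      fun n => hnonconst (n + 1) n.succ_pos⟩
  refine ⟨?_, fun z hz => ?_, fun z hz => h.isEventuallyIsometric_iff hz⟩
  · by_cases hs : HyperbolicClassification.IsSemiContracting U f
    · exact Or.inr (Or.inl ⟨h.not_isContracting_of_isSemiContracting hs, hs,
        h.not_isEventuallyIsometric_of_isSemiContracting hs⟩)
    by_cases hi : HyperbolicClassification.IsEventuallyIsometric U f
    · exact Or.inr (Or.inr ⟨h.not_isContracting_of_isEventuallyIsometric hi, hs, hi⟩)
    · exact Or.inl ⟨by_contra fun hc => hs (h.isSemiContracting_of_not hc hi), hs, hi⟩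
  · simp only [HyperbolicClassification.sum_Icc_one_eq_sum_range]
    exact h.isContracting_iff hz
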